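/- Let $n,d\in\mathbb N$, $\Phi(x)=(x,x^2,\dots,x^d)^\top$, $\nabla\Phi=\Phi'$, $\nabla^2\Phi=\Phi''$ (componentwise). For each $i\in[n]$ let $\mathcal X_i\subset\mathbb R$ be a compact interval, $\theta_i^*\in\mathbb R^d$, and let $x_i^*:\mathbb R\to\mathcal X_i$ be a best-response map, $x_i^*(p)\in\arg\min_{x\in\mathcal X_i}(\theta_i^{*\top}\Phi(x)+px)$ for all $p\in\mathbb R$. Let $\Psi:\mathbb R^n\to\mathbb R$ and let $x_{\rm des}\in\arg\min_{x\in\prod_i\mathcal X_i}\Psi(x)$ with $x_{i,\rm des}\in\operatorname{int}\mathcal X_i$ for every $i$. Assume that for every $i$ there are $m_i,M_i>0$ with $m_i\le\theta_i^{*\top}\nabla^2\Phi(x)\le M_i$ for all $x\in\mathcal X_i$. Fix $\gamma\in[\tfrac23,1)$, $\sigma^2>0$, symmetric positive definite matrices $\Sigma_i(0)\in\mathbb R^{d\times d}$ and vectors $\hat\theta_i(0)\in\mathbb R^d$, and put $A(t)=t^\gamma\log t$ for $t\ge1$, $A(0)=0$. For each $i$ let $\{\varepsilon_i(t)\}_{t\ge1}$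 be i.i.d. $\mathcal N(0,\sigma^2)$ and let $\{e_i(t)\}_{t\ge1}$ be random variables on the same probability space. The algorithm runs, for each $i$ and $t=1,2,\dots$, as follows. - Exploration: if $\operatorname{tr}\Sigma_i(t-1)>A(t-1)^{-1}$ (where $0^{-1}=+\infty$), issue $p_i(t)=\varepsilon_i(t)$, let $x_i(t)=x_i^*(p_i(t))$, $\xi_i(t)=\nabla\Phi(x_i(t))$, $\delta_i(t)=\mathbf 1\{x_i(t)\in\operatorname{int}\mathcal X_i\}$, $\hat p_i(t)=-\theta_i^{*\top}\xi_i(t)+e_i(t)$, and set $$\Sigma_i(t)=\Sigma_i(t-1)-\delta_i(t)\frac{\Sigma_i(t-1)\xi_i(t)\xi_i(t)^\top\Sigma_i(t-1)}{1+\delta_i(t)\xi_i(t)^\top\Sigma_i(t-1)\xi_i(t)},$$ $$\hat\theta_i(t)=\hat\theta_i(t-1)-\delta_i(t)\Sigma_i(t)\xi_i(t)\big(\hat p_i(t)+\xi_i(t)^\top\hat\theta_i(t-1)\big).$$ - Exploitation: otherwise issue $p_i(t)=-\hat\theta_i(t-1)^\top\nabla\Phi(x_{i,\rm des})$, let $x_i(t)=x_i^*(p_i(t))$,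 and set $\Sigma_i(t)=\Sigma_i(t-1)$, $\hat\theta_i(t)=\hat\theta_i(t-1)$. Assume that for each $i$ the noise $\{e_i(t)\}_{t\ge1}$ is i.i.d. with mean zero, that $\sup_{t\ge1}\mathbb E|e_i(t)|^a<\infty$ for some $a>2$, and that for every $t\ge1$ the variable $e_i(t)$ is independent of $(x_i(1),\dots,x_i(t),e_i(1),\dots,e_i(t-1))$. Then for every $i\in[n]$ $$\|\hat\theta_i(t)-\theta_i^*\|_2^2=O(t^{-\gamma})\quad\text{a.s.},$$ and the regret $R_t=\sum_{\tau=1}^t\|x(\tau)-x_{\rm des}\|_2^2$, $x(\tau)=(x_1(\tau),\dots,x_n(\tau))^\top$, satisfies $$R_t=O(t^\gamma\log t)\quad\text{a.s.},$$ hence $R_t=o(t)$ a.s. -/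

import Mathlib

open MeasureTheory ProbabilityTheory Filter Asymptotics Matrix
open scoped NNReal ENNReal

noncomputable section

namespace RAID

/-- The monomial basis `Φ(x) = (x, x², …, x^d)`. -/
def basis (d : ℕ) (x : ℝ) : Fin d → ℝ := fun k => x ^ (k.val + 1)

/-- The (componentwise) first derivative `∇Φ`. -/
def gradBasis (d : ℕ) : ℝ → Fin d → ℝ := deriv (basis d)

/-- The (componentwise) second derivative `∇²Φ`. -/
def hessBasis (d : ℕ) : ℝ → Fin d → ℝ := deriv (gradBasis d)

theorem gradBasis_apply (d : ℕ) (x : ℝ) (k : Fin d) :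
    gradBasis d x k = (k.val + 1) * x ^ k.val := by
  have h : HasDerivAt (basis d) (fun k : Fin d => ((k.val : ℝ) + 1) * x ^ k.val) x := by
    rw [hasDerivAt_pi]
    intro k
    simpa [basis] using hasDerivAt_pow (k.val + 1) x
  rw [gradBasis, h.deriv]

theorem hessBasis_apply (d : ℕ) (x : ℝ) (k : Fin d) :
    hessBasis d x k = (k.val + 1) * (k.val * x ^ (k.val - 1)) := by
  have h : HasDerivAt (gradBasis d)
      (fun k : Fin d => ((k.val : ℝ) + 1) * (k.val * x ^ (k.val - 1))) x := by
    rw [hasDerivAt_pi]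
    intro k
    simp only [gradBasis_apply]
    exact (hasDerivAt_pow k.val x).const_mul _
  rw [hessBasis, h.deriv]

/-- The set of minimizers of the social cost `Ψ` over the feasible set `S`. -/
def socialOptima {n : ℕ} (Ψ : (Fin n → ℝ) → ℝ) (S : Set (Fin n → ℝ)) : Set (Fin n → ℝ) :=
  {x | x ∈ S ∧ IsMinOn Ψ S x}

/-- The admissible types: `m ≤ θᵀ ∇²Φ(x) ≤ M` for all `x ∈ X`. -/
def admissibleTypes {d : ℕ} (X : Set ℝ) (m M : ℝ) : Set (Fin d → ℝ) :=
  {θ | ∀ x ∈ X, m ≤ θ ⬝ᵥ hessBasis d x ∧ θ ⬝ᵥ hessBasis d x ≤ M}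

/-- The cost `θᵀ Φ(x) + p x` of an agent of type `θ` under the incentive rate `p`. -/
def cost {d : ℕ} (θ : Fin d → ℝ) (x p : ℝ) : ℝ := θ ⬝ᵥ basis d x + p * x

/-- `br` is a best-response map on the strategy set `X`. -/
def IsBestResponse {d : ℕ} (X : Set ℝ) (θ : Fin d → ℝ) (br : ℝ → ℝ) : Prop :=
  ∀ p, br p ∈ X ∧ IsMinOn (fun x => cost θ x p) X (br p)

/-- The data of one agent, together with the target strategy and the initialization
that the planner uses for this agent. -/
structure Agent (d : ℕ) where
  /-- strategy set -/
  X : Set ℝ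
  /-- true type -/
  θ : Fin d → ℝ
  /-- best-response map -/
  br : ℝ → ℝ
  /-- desired strategy -/
  xdes : ℝ
  /-- initial estimate -/
  est₀ : Fin d → ℝ
  /-- initial matrix `Σ(0)` -/
  cov₀ : Matrix (Fin d) (Fin d) ℝ

/-- The planner's state for one agent: the estimate `θ̂(t)` and the matrix `Σ(t)`. -/
structure State (d : ℕ) where
  est : Fin d → ℝ
  cov : Matrix (Fin d) (Fin d) ℝ

/-- `A(t) = t^γ log t`. -/
def A (γ : ℝ) (t : ℕ) : ℝ := (t : ℝ) ^ γ * Real.log t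

/-- The exploration test `tr Σ > A(t)⁻¹`, with the denominator cleared, so that it reads
`A(t)⁻¹ = +∞` (exploitation) at the times `t = 0, 1` where `A(t) = 0`. -/
def Explores {d : ℕ} (γ : ℝ) (t : ℕ) (S : Matrix (Fin d) (Fin d) ℝ) : Prop :=
  1 < A γ t * S.trace

open Classical in
/-- The incentive issued at time `t + 1` from the state at time `t`: the probing value `probe` in
an exploration step, the certainty-equivalent incentive in an exploitation step. -/
def incentive {d : ℕ} (γ : ℝ) (xdes : ℝ) (t : ℕ) (s : State d) (probe : ℝ) : ℝ :=
  if Explores γ t s.cov then probe else -(s.est ⬝ᵥ gradBasis d xdes)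

/-- The noisy incentive `p̂ = -θᵀ ∇Φ(x) + e` seen by the estimator. -/
def observation {d : ℕ} (θ : Fin d → ℝ) (x e : ℝ) : ℝ := -(θ ⬝ᵥ gradBasis d x) + e

/-- `δ = 1` if `x` is interior to `X`, and `δ = 0` otherwise. -/
def informative (X : Set ℝ) (x : ℝ) : ℝ := (interior X).indicator 1 x

/-- The recursive least-squares update of `Σ`. -/
def covUpdate {d : ℕ} (X : Set ℝ) (S : Matrix (Fin d) (Fin d) ℝ) (x : ℝ) :
    Matrix (Fin d) (Fin d) ℝ :=
  let ξ := gradBasis d x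
  let δ := informative X x
  S - (δ / (1 + δ * (ξ ⬝ᵥ S *ᵥ ξ))) • (S * vecMulVec ξ ξ * S)

/-- The recursive least-squares update of `(θ̂, Σ)` after the response `x` and observation `p`. -/
def lsUpdate {d : ℕ} (X : Set ℝ) (s : State d) (x p : ℝ) : State d :=
  let ξ := gradBasis d x
  let δ := informative X x
  let S := covUpdate X s.cov x
  { est := s.est - (δ * (p + ξ ⬝ᵥ s.est)) • (S *ᵥ ξ)
    cov := S }

open Classical in
/-- The planner's state after `t` rounds of the switching algorithm, for the probing values
`ε 1, ε 2, …` and the noise values `e 1, e 2, …`. -/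
def Agent.state {d : ℕ} (g : Agent d) (γ : ℝ) (ε e : ℕ → ℝ) : ℕ → State d
  | 0 => { est := g.est₀, cov := g.cov₀ }
  | t + 1 =>
    let s := g.state γ ε e t
    let x := g.br (incentive γ g.xdes t s (ε (t + 1)))
    if Explores γ t s.cov then lsUpdate g.X s x (observation g.θ x (e (t + 1))) else s

/-- The estimate `θ̂(t)`. -/
def Agent.estimate {d : ℕ} (g : Agent d) (γ : ℝ) (ε e : ℕ → ℝ) (t : ℕ) : Fin d → ℝ :=
  (g.state γ ε e t).est

/-- The incentive `p(t)` issued in round `t ≥ 1`. -/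
def Agent.price {d : ℕ} (g : Agent d) (γ : ℝ) (ε e : ℕ → ℝ) (t : ℕ) : ℝ :=
  incentive γ g.xdes (t - 1) (g.state γ ε e (t - 1)) (ε t)

/-- The response `x(t) = x*(p(t))` in round `t ≥ 1`. -/
def Agent.response {d : ℕ} (g : Agent d) (γ : ℝ) (ε e : ℕ → ℝ) (t : ℕ) : ℝ :=
  g.br (g.price γ ε e t)

/-- The regret `R_t = ∑_{τ=1}^t ‖x(τ) - x_des‖₂²`. -/
def regret {n d : ℕ} (g : Fin n → Agent d) (γ : ℝ) (ε e : Fin n → ℕ → ℝ) (t : ℕ) : ℝ :=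
  ∑ τ ∈ Finset.Icc 1 t,
    ‖WithLp.toLp 2 (fun i => (g i).response γ (ε i) (e i) τ - (g i).xdes)‖ ^ 2

end RAID

end

/-! Let `T(t)` be the number of exploration rounds up to `t` and `J(t) = Σ(t)⁻¹` the information
matrix. By Sherman–Morrison, `J(t)` is `Σ(0)⁻¹` plus the sum of `δ ξ ξᵀ` over exploration rounds,
and the estimation error solves `J(t) (θ̂(t) - θ) = b - N(t)`, with `b` fixed and `N(t)` the
weighted noise sum.

Whether to explore depends on `Σ`, hence only on earlier probes. So `J(t) - Σ(0)⁻¹ - T(t) G` is a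
martingale, where `G` is the mean information of one Gaussian probe. `G` is positive definite: a
nonzero polynomial has finitely many roots, and a Gaussian charges every open set of prices but no
finite one (`posDef_meanInformation`).

The probabilistic tool is `ae_sq_sum_mul_le_mul_log`: a martingale transform with bounded weights,
active only in rounds where `T` increases, is almost surely `O(√(T log T))`. It rests on a
supermartingale built from `|S|^p` with `2 < p ≤ 3`, normalized at the random time `T`. Applied to
the entries of `J`, it gives `J ≥ c (T + 1)`, so `tr Σ ≤ K / (T + 1)`; an exploring round needs `A
tr Σ > 1`, whence `T(t) ≤ K A(t)`. Applied to the noise, it gives `N² = O(T log T)`.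

Conversely, `T(t) = o(t)`, so the test failed at some time of order `t`, and `tr Σ(t) ≤ 4 / A(t)`
eventually. The squared error is therefore of order `A⁻² · A log t = t^(-γ)`. For the regret,
exploration costs `O(T) = O(A)`. In exploitation rounds the best response is Lipschitz in the price,
so they cost `∑ s^(-γ) = O(√t) = O(A)`, because `γ ≥ 1/2`. -/

/-! ### Scalar inequalities for powers of the absolute value. -/

theorem abs_rpow_tangent_le {p : ℝ} (hp : 1 < p) (x z : ℝ) :
    |z| ^ p + p * (|z| ^ (p - 2) * z) * (x - z) ≤ |x| ^ p := by
  rcases eq_or_ne z 0 with rfl | hz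
  · have := Real.rpow_nonneg (abs_nonneg x) p
    simpa [Real.zero_rpow (by linarith : p ≠ 0)] using this
  have hz' : 0 < |z| := abs_pos.2 hz
  have hq : p.HolderConjugate (Real.conjExponent p) := Real.HolderConjugate.conjExponent hp
  -- Young's inequality for `|x|` and `|z|^(p-1)` is the tangent-line inequality of the convex
  -- function `|·|^p`.
  have hy := Real.young_inequality_of_nonneg (abs_nonneg x)
    (Real.rpow_nonneg (abs_nonneg z) (p - 1)) hq
  rw [← Real.rpow_mul (abs_nonneg z)] at hy
  have h1 : (p - 1) * Real.conjExponent p = p := hq.sub_one_mul_conj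
  rw [h1] at hy
  have h2 : |z| ^ p = |z| ^ (p - 2) * z * z := by
    rw [show p = (p - 2) + 2 by ring, Real.rpow_add hz', show p - 2 + 2 - 2 = p - 2 by ring]
    have : |z| ^ (2 : ℝ) = z ^ 2 := by
      rw [← sq_abs z]; exact_mod_cast Real.rpow_natCast |z| 2
    rw [this]; ring
  have h3 : |z| ^ (p - 2) * z * x ≤ |x| * |z| ^ (p - 1) := by
    rw [show p - 1 = (p - 2) + 1 by ring, Real.rpow_add hz', Real.rpow_one]
    have : z * x ≤ |z| * |x| := by rw [← abs_mul]; exact le_abs_self _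
    have h0 := Real.rpow_nonneg (abs_nonneg z) (p - 2)
    nlinarith [mul_le_mul_of_nonneg_left this h0]
  have h4 : (Real.conjExponent p)⁻¹ = 1 - p⁻¹ := by
    have := hq.inv_add_inv_eq_one; linarith
  have hp0 : 0 < p := by linarith
  rw [div_eq_mul_inv, div_eq_mul_inv, h4] at hy
  have h5 : p * (|x| ^ p * p⁻¹ + |z| ^ p * (1 - p⁻¹)) = |x| ^ p + (p - 1) * |z| ^ p := by
    field_simp
  have h6 := mul_le_mul_of_nonneg_left (h3.trans hy) hp0.le
  rw [h5] at h6
  nlinarith [h6, h2]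

/-- Continuity estimate for `u ↦ |u|^r u`, which is the derivative of `|·|^p` up to a factor when `r
= p - 2`. Since `r ≤ 1` and `|b|/|a| ≤ 1`, one has `|b|/|a| ≤ (|b|/|a|)^r`, which controls the
change of the factor `|·|^r`. -/
theorem abs_rpow_mul_self_sub_le_of_abs_le {r : ℝ} (hr0 : 0 ≤ r) (hr1 : r ≤ 1) {a b : ℝ}
    (hab : |b| ≤ |a|) : |(|a| ^ r * a - |b| ^ r * b)| ≤ 2 * |a| ^ r * |a - b| := by
  have hua := abs_nonneg a
  have hub := abs_nonneg b
  have hmono : |b| ^ r ≤ |a| ^ r := Real.rpow_le_rpow hub hab hr0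
  have har := Real.rpow_nonneg hua r
  have hbr := Real.rpow_nonneg hub r
  have key : (|a| ^ r - |b| ^ r) * |b| ≤ |a| ^ r * (|a| - |b|) := by
    rcases hua.eq_or_lt with h | h
    · have hb : |b| = 0 := le_antisymm (hab.trans h.symm.le) hub
      rw [hb, ← h]; simp
    · have h1 : |b| * |a| ^ r ≤ |b| ^ r * |a| := by
        have hq0 : 0 ≤ |b| / |a| := by positivity
        have hq1 : |b| / |a| ≤ 1 := (div_le_one h).2 hab
        have h2 : |b| / |a| ≤ (|b| / |a|) ^ r := by
          rcases hq0.eq_or_lt with h' | h'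
          · rw [← h']; exact Real.rpow_nonneg le_rfl _
          · simpa using Real.rpow_le_rpow_of_exponent_ge h' hq1 hr1
        rw [Real.div_rpow hub hua, div_le_div_iff₀ h (Real.rpow_pos_of_pos h r)] at h2
        exact h2
      have h3 : |a| * ((|a| ^ r - |b| ^ r) * |b|) ≤ |a| * (|a| ^ r * (|a| - |b|)) := by
        nlinarith [mul_le_mul_of_nonneg_left h1 hub, mul_nonneg har (sq_nonneg (|a| - |b|))]
      exact le_of_mul_le_mul_left h3 h
  have hdecomp : |a| ^ r * a - |b| ^ r * b = |a| ^ r * (a - b) + (|a| ^ r - |b| ^ r) * b := by ring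
  rw [hdecomp]
  refine (abs_add_le _ _).trans ?_
  rw [abs_mul, abs_mul, abs_of_nonneg har, abs_of_nonneg (sub_nonneg.2 hmono)]
  have := mul_le_mul_of_nonneg_left (abs_sub_abs_le_abs_sub a b) har
  linarith

theorem abs_rpow_mul_self_sub_le {r : ℝ} (hr0 : 0 ≤ r) (hr1 : r ≤ 1) (x y : ℝ) :
    |(|x + y| ^ r * (x + y) - |x| ^ r * x)| ≤ 2 * (|x| ^ r + |y| ^ r) * |y| := by
  have h0 : (|x| + |y|) ^ r ≤ |x| ^ r + |y| ^ r :=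
    Real.rpow_add_le_add_rpow (abs_nonneg x) (abs_nonneg y) hr0 hr1
  have key : |(|x + y| ^ r * (x + y) - |x| ^ r * x)| ≤ 2 * (|x| + |y|) ^ r * |y| := by
    rcases le_total |x| |x + y| with h | h
    · refine (abs_rpow_mul_self_sub_le_of_abs_le hr0 hr1 h).trans ?_
      rw [add_sub_cancel_left]
      gcongr
      exact abs_add_le x y
    · rw [abs_sub_comm]
      refine (abs_rpow_mul_self_sub_le_of_abs_le hr0 hr1 h).trans ?_
      rw [sub_add_cancel_left, abs_neg]
      gcongr
      linarith [abs_nonneg y]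
  refine key.trans ?_
  gcongr

/-- Second-order upper bound for `|·| ^ p`, `2 ≤ p ≤ 3`. -/
theorem abs_add_rpow_le {p : ℝ} (hp2 : 2 ≤ p) (hp3 : p ≤ 3) (x y : ℝ) :
    |x + y| ^ p ≤ |x| ^ p + p * (|x| ^ (p - 2) * x) * y
      + 2 * p * (|x| ^ (p - 2) * y ^ 2 + |y| ^ p) := by
  -- The tangent is taken at `x + y`, so that convexity bounds `|x + y|^p` from above. Moving the
  -- slope back to `x` costs the remainder and needs `p - 2 ≤ 1`.
  have h1 := abs_rpow_tangent_le (by linarith : 1 < p) x (x + y)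
  have h2 := abs_rpow_mul_self_sub_le (r := p - 2) (by linarith) (by linarith) x y
  have h3 : |y| ^ p = |y| ^ (p - 2) * y ^ 2 := by
    rcases eq_or_ne y 0 with rfl | hy
    · simp [Real.zero_rpow (by linarith : p ≠ 0)]
    · conv_lhs => rw [show p = (p - 2) + 2 by ring, Real.rpow_add (abs_pos.2 hy)]
      rw [← sq_abs y]; congr 1; exact_mod_cast Real.rpow_natCast |y| 2
  have h4 : (|x + y| ^ (p - 2) * (x + y) - |x| ^ (p - 2) * x) * y
      ≤ 2 * (|x| ^ (p - 2) + |y| ^ (p - 2)) * y ^ 2 := by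
    refine (le_abs_self _).trans ?_
    rw [abs_mul, ← sq_abs y]
    nlinarith [mul_le_mul_of_nonneg_right h2 (abs_nonneg y)]
  have h5 := mul_le_mul_of_nonneg_left h4 (by linarith : 0 ≤ p)
  rw [h3]
  nlinarith [h1, h5]

/-- A Young inequality with the powers balanced at the scale `N`. -/
theorem rpow_sub_two_mul_le {p b N u : ℝ} (hp : 2 ≤ p) (hb : 0 ≤ b) (hN : 0 < N) (hu : 0 ≤ u) :
    u ^ (p - 2) * b ≤ u ^ p / N + b ^ (p / 2) * N ^ (p / 2 - 1) := by
  have hup : u ^ p = u ^ (p - 2) * u ^ 2 := by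
    rcases hu.eq_or_lt with h | h
    · rw [← h]; simp [Real.zero_rpow (by linarith : p ≠ 0)]
    · conv_lhs => rw [show p = (p - 2) + 2 by ring, Real.rpow_add h]
      congr 1; exact_mod_cast Real.rpow_natCast u 2
  have hu2 := Real.rpow_nonneg hu (p - 2)
  -- One of the two terms on the right suffices, according to whether `u²` exceeds `b N`.
  rcases le_total (b * N) (u ^ 2) with h | h
  · have : u ^ (p - 2) * b ≤ u ^ p / N := by
      rw [le_div_iff₀ hN, hup, mul_assoc]; gcongr
    have h2 : 0 ≤ b ^ (p / 2) * N ^ (p / 2 - 1) := by positivity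
    linarith
  · have h1 : u ^ (p - 2) ≤ (b * N) ^ (p / 2 - 1) := by
      have : u ^ (p - 2) = (u ^ 2) ^ (p / 2 - 1) := by
        rw [← Real.rpow_natCast u 2, ← Real.rpow_mul hu]; congr 1; push_cast; ring
      rw [this]; exact Real.rpow_le_rpow (by positivity) h (by linarith)
    have h3 : (b * N) ^ (p / 2 - 1) * b = b ^ (p / 2) * N ^ (p / 2 - 1) := by
      rw [Real.mul_rpow hb hN.le]
      rcases hb.eq_or_lt with h | h
      · rw [← h]; simp [Real.zero_rpow (by linarith : p / 2 ≠ 0)]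
      · conv_rhs => rw [show p / 2 = (p / 2 - 1) + 1 by ring, Real.rpow_add h, Real.rpow_one]
        rw [show p / 2 - 1 + 1 - 1 = p / 2 - 1 by ring]; ring
    have h4 : 0 ≤ u ^ p / N := by positivity
    have := mul_le_mul_of_nonneg_right h1 hb
    linarith

/-! ### The normalizing sequence and its summable budget. -/

/-- The normalization `((k + 2) log (k + 2)) ^ (p / 2)`. -/
noncomputable def logNorm (p : ℝ) (k : ℕ) : ℝ :=
  (((k : ℝ) + 2) * Real.log (k + 2)) ^ (p / 2)

/-- The tail budget `log (k + 2) ^ (1 - p / 2)`. -/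
noncomputable def logBudget (p : ℝ) (k : ℕ) : ℝ := Real.log (k + 2) ^ (1 - p / 2)

theorem log_add_two_pos (k : ℕ) : 0 < Real.log ((k : ℝ) + 2) :=
  Real.log_pos (by have : (0 : ℝ) ≤ k := k.cast_nonneg; linarith)

theorem logNorm_pos (p : ℝ) (k : ℕ) : 0 < logNorm p k := by
  have := log_add_two_pos k
  unfold logNorm; positivity

theorem logBudget_nonneg (p : ℝ) (k : ℕ) : 0 ≤ logBudget p k :=
  Real.rpow_nonneg (log_add_two_pos k).le _

/-- The growth of the normalization absorbs the factor `1 + 1/(k+3)` produced by Young's inequality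
at the scale `k + 3`; the linear factor raised to `p/2 ≥ 1` already suffices. -/
theorem logNorm_mul_le_succ {p : ℝ} (hp : 2 ≤ p) (k : ℕ) :
    logNorm p k * (1 + 1 / ((k : ℝ) + 3)) ≤ logNorm p (k + 1) := by
  have hk : (0 : ℝ) ≤ k := k.cast_nonneg
  have hl := log_add_two_pos k
  have hl' : Real.log ((k : ℝ) + 2) ≤ Real.log ((k : ℝ) + 3) :=
    Real.log_le_log (by linarith) (by linarith)
  unfold logNorm
  push_cast
  rw [show (k : ℝ) + 1 + 2 = k + 3 by ring]
  have h1 : 1 + 1 / ((k : ℝ) + 3) ≤ (((k : ℝ) + 3) / (k + 2)) ^ (p / 2) := by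
    have hb : 1 ≤ ((k : ℝ) + 3) / (k + 2) := by rw [le_div_iff₀ (by linarith)]; linarith
    calc 1 + 1 / ((k : ℝ) + 3) ≤ ((k : ℝ) + 3) / (k + 2) := by
          rw [add_div' _ _ _ (by linarith), div_le_div_iff₀ (by linarith) (by linarith)]; nlinarith
      _ = (((k : ℝ) + 3) / (k + 2)) ^ (1 : ℝ) := (Real.rpow_one _).symm
      _ ≤ _ := Real.rpow_le_rpow_of_exponent_le hb (by linarith)
  calc _ ≤ (((k : ℝ) + 2) * Real.log (k + 2)) ^ (p / 2) * (((k : ℝ) + 3) / (k + 2)) ^ (p / 2) := by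
        gcongr
    _ = (((k : ℝ) + 3) * Real.log (k + 2)) ^ (p / 2) := by
        rw [← Real.mul_rpow (by positivity) (by positivity)]; congr 1; field_simp
    _ ≤ _ := by gcongr

/-- The quotient equals `1 / ((k+3) log(k+3)^(p/2))`, summable because `p > 2`, and the budget is a
discrete primitive of it. The bound follows from the Bernoulli inequality for the exponent `-(p/2 -
1)` and `log(k+3) - log(k+2) ≥ 1/(k+3)`. -/
theorem logBudget_sub_succ_ge {p : ℝ} (hp : 2 < p) (k : ℕ) :
    (p / 2 - 1) * (((k : ℝ) + 3) ^ (p / 2 - 1) / logNorm p (k + 1))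
      ≤ logBudget p k - logBudget p (k + 1) := by
  have hk : (0 : ℝ) ≤ k := k.cast_nonneg
  have hu := log_add_two_pos k
  have hv : 0 < Real.log ((k : ℝ) + 3) := Real.log_pos (by linarith)
  have hduv : 1 / ((k : ℝ) + 3) ≤ Real.log (k + 3) - Real.log (k + 2) := by
    have := Real.one_sub_inv_le_log_of_pos (x := ((k : ℝ) + 3) / (k + 2)) (by positivity)
    rw [Real.log_div (by linarith) (by linarith)] at this
    refine le_trans (le_of_eq ?_) this
    field_simp; ring
  unfold logBudget logNorm
  push_cast
  rw [show (k : ℝ) + 1 + 2 = k + 3 by ring]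
  set u := Real.log ((k : ℝ) + 2)
  set v := Real.log ((k : ℝ) + 3)
  set a := p / 2 - 1 with ha
  have ha0 : 0 < a := by rw [ha]; linarith
  rw [show 1 - p / 2 = -a by rw [ha]; ring, show p / 2 = a + 1 by rw [ha]; ring]
  have h1 : 1 + a * (1 - u / v) ≤ (u / v) ^ (-a) := by
    have huv : 0 < u / v := by positivity
    rw [Real.rpow_def_of_pos huv]
    have h2 := Real.add_one_le_exp (Real.log (u / v) * -a)
    have h3 := Real.log_le_sub_one_of_pos huv
    nlinarith
  have h2 : u ^ (-a) = (u / v) ^ (-a) * v ^ (-a) := by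
    rw [← Real.mul_rpow (by positivity) hv.le]; congr 1; field_simp
  have hva : 0 < v ^ (-a) := by positivity
  have h3 : a * (((k : ℝ) + 3) ^ a / (((k : ℝ) + 3) * v) ^ (a + 1))
      = v ^ (-a) * (a * ((1 / ((k : ℝ) + 3)) / v)) := by
    rw [Real.mul_rpow (by linarith) hv.le, Real.rpow_add (by linarith : (0 : ℝ) < k + 3),
      Real.rpow_add hv, Real.rpow_one, Real.rpow_one, Real.rpow_neg hv.le]
    field_simp
  have h4 : (1 / ((k : ℝ) + 3)) / v ≤ 1 - u / v := by
    rw [one_sub_div hv.ne']; gcongr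
  rw [h3, h2]
  have h5 := mul_le_mul_of_nonneg_left h1 hva.le
  have h6 := mul_le_mul_of_nonneg_left (mul_le_mul_of_nonneg_left h4 ha0.le) hva.le
  nlinarith

theorem logNorm_mono {p : ℝ} (hp : 2 ≤ p) : Monotone (logNorm p) := by
  refine monotone_nat_of_le_succ fun k => le_trans ?_ (logNorm_mul_le_succ hp k)
  have h : (0 : ℝ) ≤ 1 / ((k : ℝ) + 3) := by positivity
  nlinarith [logNorm_pos p k]

theorem logBudget_anti {p : ℝ} (hp : 2 < p) : Antitone (logBudget p) := by
  refine antitone_nat_of_succ_le fun k => ?_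
  have h := logBudget_sub_succ_ge hp k
  have h1 : 0 ≤ (p / 2 - 1) * (((k : ℝ) + 3) ^ (p / 2 - 1) / logNorm p (k + 1)) := by
    have := logNorm_pos p (k + 1)
    have : 0 ≤ p / 2 - 1 := by linarith
    positivity
  linarith

/-- The drift of `|x| ^ p / logNorm` is paid for by the decrease of the budget. -/
theorem exists_budget_step {p B K : ℝ} (hp : 2 < p) (hB : 0 ≤ B) (hK : 0 ≤ K) :
    ∃ C : ℝ, 0 ≤ C ∧ ∀ (k : ℕ) (x w v κ : ℝ), |w| ≤ B → v ≤ K → κ ≤ K →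
      (|x| ^ p + 2 * p * |x| ^ (p - 2) * w ^ 2 * v + 2 * p * |w| ^ p * κ) / logNorm p (k + 1)
        + C * logBudget p (k + 1) ≤ |x| ^ p / logNorm p k + C * logBudget p k := by
  set b := 2 * p * B ^ 2 * K with hb
  have hb0 : 0 ≤ b := by positivity
  set C₂ := b ^ (p / 2) + 2 * p * B ^ p * K with hC₂
  have hC₂0 : 0 ≤ C₂ := by positivity
  have ha : 0 < p / 2 - 1 := by linarith
  -- `C₂` is the total coefficient of `(k+3)^(p/2-1)` after Young's inequality; the division cancels
  -- the factor `p/2 - 1` in `logBudget_sub_succ_ge`.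
  refine ⟨C₂ / (p / 2 - 1), by positivity, fun k x w v κ hw hv hκ => ?_⟩
  have hk : (0 : ℝ) ≤ k := k.cast_nonneg
  have hc := logNorm_pos p k
  have hc' := logNorm_pos p (k + 1)
  have hx := Real.rpow_nonneg (abs_nonneg x) p
  have hx2 := Real.rpow_nonneg (abs_nonneg x) (p - 2)
  have hN : (1 : ℝ) ≤ ((k : ℝ) + 3) ^ (p / 2 - 1) := Real.one_le_rpow (by linarith) ha.le
  have h1 := rpow_sub_two_mul_le hp.le hb0 (by linarith : (0 : ℝ) < k + 3) (abs_nonneg x)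
  have hw2 : w ^ 2 ≤ B ^ 2 := by rw [← sq_abs]; gcongr
  have hwp : |w| ^ p ≤ B ^ p := Real.rpow_le_rpow (abs_nonneg w) hw (by linarith)
  have h2 : 2 * p * |x| ^ (p - 2) * w ^ 2 * v ≤ |x| ^ (p - 2) * b := by
    calc 2 * p * |x| ^ (p - 2) * w ^ 2 * v ≤ 2 * p * |x| ^ (p - 2) * w ^ 2 * K := by gcongr
      _ ≤ 2 * p * |x| ^ (p - 2) * B ^ 2 * K := by gcongr
      _ = _ := by rw [hb]; ring
  have h3 : 2 * p * |w| ^ p * κ ≤ 2 * p * B ^ p * K := by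
    calc 2 * p * |w| ^ p * κ ≤ 2 * p * |w| ^ p * K := by gcongr
      _ ≤ _ := by gcongr
  have h4 : |x| ^ p + 2 * p * |x| ^ (p - 2) * w ^ 2 * v + 2 * p * |w| ^ p * κ
      ≤ |x| ^ p * (1 + 1 / ((k : ℝ) + 3)) + C₂ * ((k : ℝ) + 3) ^ (p / 2 - 1) := by
    have h5 : 2 * p * B ^ p * K ≤ 2 * p * B ^ p * K * ((k : ℝ) + 3) ^ (p / 2 - 1) :=
      le_mul_of_one_le_right (by positivity) hN
    rw [hC₂]
    have h6 : |x| ^ p / ((k : ℝ) + 3) = |x| ^ p * (1 / ((k : ℝ) + 3)) := by ring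
    rw [h6] at h1
    linarith
  have h7 : |x| ^ p * (1 + 1 / ((k : ℝ) + 3)) / logNorm p (k + 1) ≤ |x| ^ p / logNorm p k := by
    rw [div_le_div_iff₀ hc' hc, mul_assoc]
    gcongr
    rw [mul_comm]; exact logNorm_mul_le_succ hp.le k
  have h8 := mul_le_mul_of_nonneg_left (logBudget_sub_succ_ge hp k)
    (by positivity : 0 ≤ C₂ / (p / 2 - 1))
  have h9 : C₂ / (p / 2 - 1) * ((p / 2 - 1) * (((k : ℝ) + 3) ^ (p / 2 - 1) / logNorm p (k + 1)))
      = C₂ * ((k : ℝ) + 3) ^ (p / 2 - 1) / logNorm p (k + 1) := by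
    rw [← mul_assoc, div_mul_cancel₀ _ ha.ne', mul_div_assoc]
  rw [h9] at h8
  have h10 := div_le_div_of_nonneg_right h4 hc'.le
  rw [add_div (|x| ^ p * _)] at h10
  linarith

/-! ### Almost sure growth of martingale transforms. -/

/-- The conditional expectation of `f h` given the past, in set-integral form: the indicator of a
past event can be merged into `f`, after which independence factors the integral. -/
theorem Indep.integrable_mul_and_setIntegral_mul {Ω : Type*} {m₁ m₂ m0 : MeasurableSpace Ω}
    {P : Measure Ω} (h₂ : m₂ ≤ m0)
    (hind : Indep m₁ m₂ P) {f h : Ω → ℝ} (hf : Measurable[m₂] f) (hh : Measurable[m₁] h)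
    (hfi : Integrable f P) (hhi : Integrable h P) :
    Integrable (fun ω => f ω * h ω) P ∧ ∀ s, MeasurableSet[m₂] s →
      ∫ ω in s, f ω * h ω ∂P = (∫ ω in s, f ω ∂P) * ∫ ω, h ω ∂P := by
  have key : ∀ {f : Ω → ℝ}, Measurable[m₂] f → IndepFun f h P := fun hf =>
    (indep_of_indep_of_le_left (indep_of_indep_of_le_right hind hf.comap_le) hh.comap_le).symm
  refine ⟨(key hf).integrable_mul hfi hhi, fun s hs => ?_⟩
  have hs0 := h₂ s hs
  rw [← integral_indicator hs0, ← integral_indicator hs0]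
  rw [← (key (hf.indicator hs)).integral_fun_mul_eq_mul_integral
    (hfi.indicator hs0).aestronglyMeasurable hhi.aestronglyMeasurable]
  congr 1 with ω
  by_cases h : ω ∈ s <;> simp [h]

theorem rpow_le_one_add_rpow {u r p : ℝ} (hu : 0 ≤ u) (hr : 0 ≤ r) (hrp : r ≤ p) :
    u ^ r ≤ 1 + u ^ p := by
  rcases le_total u 1 with h | h
  · have := Real.rpow_le_one hu h hr
    have := Real.rpow_nonneg hu p
    linarith
  · have := Real.rpow_le_rpow_of_exponent_le h hrp
    linarith

theorem abs_rpow_sub_two_mul_self (p : ℝ) (x : ℝ) :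
    |(|x| ^ (p - 2) * x)| = |x| ^ (p - 1) ∨ x = 0 := by
  rcases eq_or_ne x 0 with h | h
  · exact Or.inr h
  · left
    rw [abs_mul, abs_of_nonneg (Real.rpow_nonneg (abs_nonneg x) _),
      show p - 1 = (p - 2) + 1 by ring, Real.rpow_add (abs_pos.2 h), Real.rpow_one]

/-- A nonnegative supermartingale is almost surely bounded. -/
theorem MeasureTheory.Supermartingale.ae_bddAbove {Ω : Type*} {m0 : MeasurableSpace Ω}
    {P : Measure Ω} [IsFiniteMeasure P] {𝓕 : Filtration ℕ m0} {Z : ℕ → Ω → ℝ}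
    (hZ : Supermartingale Z 𝓕 P) (h0 : ∀ t ω, 0 ≤ Z t ω) :
    ∀ᵐ ω ∂P, ∃ C, ∀ t, Z t ω ≤ C := by
  -- Nonnegativity turns decreasing means into an `L¹` bound, so the submartingale `-Z` converges
  -- almost surely.
  have hb : ∀ t, eLpNorm ((-Z) t) 1 P ≤ (Real.toNNReal (∫ ω, Z 0 ω ∂P) : ℝ≥0∞) := by
    intro t
    have h1 : ∫ ω, Z t ω ∂P ≤ ∫ ω, Z 0 ω ∂P := by
      simpa using hZ.setIntegral_le (Nat.zero_le t) MeasurableSet.univ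
    rw [Pi.neg_apply, eLpNorm_neg, eLpNorm_one_eq_lintegral_enorm,
      ← ofReal_integral_norm_eq_lintegral_enorm (hZ.integrable t)]
    simp only [Real.norm_eq_abs, abs_of_nonneg (h0 t _)]
    exact ENNReal.ofReal_le_ofReal h1
  filter_upwards [hZ.neg.exists_ae_tendsto_of_bdd hb] with ω ⟨c, hc⟩
  obtain ⟨C, hC⟩ := hc.neg.bddAbove_range
  refine ⟨C, fun t => ?_⟩
  simpa using hC ⟨t, rfl⟩

/-- An `L^p` martingale transform (`2 < p ≤ 3`) with bounded predictable weights that are active only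
when the counter `T` increases is almost surely `O(√(T log T))`. -/
theorem ae_sq_sum_mul_le_mul_log {Ω : Type*} {m0 : MeasurableSpace Ω} {P : Measure Ω}
    [IsProbabilityMeasure P] (𝓕 : Filtration ℕ m0) {p B K : ℝ} (hp2 : 2 < p) (hp3 : p ≤ 3)
    {e w : ℕ → Ω → ℝ} {T : ℕ → Ω → ℕ}
    (he : ∀ s, Measurable[𝓕 (s + 1)] (e s))
    (hind : ∀ s, Indep (MeasurableSpace.comap (e s) inferInstance) (𝓕 s) P)
    (hmean : ∀ s, ∫ ω, e s ω ∂P = 0)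
    (hint : ∀ s, Integrable (fun ω => |e s ω| ^ p) P)
    (hK : ∀ s, ∫ ω, |e s ω| ^ p ∂P ≤ K)
    (hw : ∀ s, Measurable[𝓕 s] (w s)) (hwB : ∀ s ω, |w s ω| ≤ B)
    (hT0 : ∀ ω, T 0 ω = 0) (hTm : ∀ s, Measurable[𝓕 s] (T (s + 1)))
    (hT : ∀ s ω, (T (s + 1) ω = T s ω ∧ w s ω = 0) ∨ T (s + 1) ω = T s ω + 1) :
    ∀ᵐ ω ∂P, ∃ C : ℝ, ∀ t, (∑ s ∈ Finset.range t, w s ω * e s ω) ^ 2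
      ≤ C * (((T t ω : ℝ) + 2) * Real.log (T t ω + 2)) := by
  have hK0 : 0 ≤ K := le_trans (integral_nonneg fun ω => by positivity) (hK 0)
  obtain ⟨ω₀⟩ : Nonempty Ω := P.nonempty_of_neZero
  have hB0 : 0 ≤ B := (abs_nonneg _).trans (hwB 0 ω₀)
  have hp0 : 0 < p := by linarith
  obtain ⟨C, hC0, hC⟩ := exists_budget_step (K := 1 + K) hp2 hB0 (by linarith)
  set S : ℕ → Ω → ℝ := fun t ω => ∑ s ∈ Finset.range t, w s ω * e s ω with hS
  have hSsucc : ∀ t ω, S (t + 1) ω = S t ω + w t ω * e t ω := fun t ω => by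
    simp [hS, Finset.sum_range_succ]
  have hSm : ∀ t, Measurable[𝓕 t] (S t) := by
    intro t
    refine Finset.measurable_sum _ fun s hs => ?_
    have hst := Finset.mem_range.1 hs
    exact ((hw s).mono (𝓕.mono hst.le) le_rfl).mul ((he s).mono (𝓕.mono hst) le_rfl)
  have hTm' : ∀ s, Measurable[𝓕 s] (T s) := by
    intro s
    cases s with
    | zero => rw [show T 0 = fun _ => 0 from funext hT0]; exact measurable_const
    | succ s => exact (hTm s).mono (𝓕.mono s.le_succ) le_rfl
  have hem : ∀ s, Measurable (e s) := fun s => (he s).mono (𝓕.le _) le_rfl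
  have hcm : ∀ s, Measurable[MeasurableSpace.comap (e s) inferInstance] (e s) :=
    fun s => comap_measurable _
  have he2 : ∀ s, Integrable (fun ω => (e s ω) ^ 2) P := by
    intro s
    refine ((integrable_const (1 : ℝ)).add (hint s)).mono' ((hem s).pow_const 2).aestronglyMeasurable
      (ae_of_all _ fun ω => ?_)
    rw [Real.norm_eq_abs, abs_of_nonneg (sq_nonneg _), ← sq_abs]
    have := rpow_le_one_add_rpow (abs_nonneg (e s ω)) (by norm_num : (0 : ℝ) ≤ 2) hp2.le
    exact_mod_cast this
  have he2K : ∀ s, ∫ ω, (e s ω) ^ 2 ∂P ≤ 1 + K := by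
    intro s
    calc ∫ ω, (e s ω) ^ 2 ∂P ≤ ∫ ω, (1 + |e s ω| ^ p) ∂P := by
          refine integral_mono (he2 s) ((integrable_const (1 : ℝ)).add (hint s)) fun ω => ?_
          have := rpow_le_one_add_rpow (abs_nonneg (e s ω)) (by norm_num : (0 : ℝ) ≤ 2) hp2.le
          simp only
          rw [← sq_abs]; exact_mod_cast this
      _ = 1 + ∫ ω, |e s ω| ^ p ∂P := by
          rw [integral_add (integrable_const _) (hint s)]; simp
      _ ≤ 1 + K := by linarith [hK s]
  have he1 : ∀ s, Integrable (e s) P := by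
    intro s
    refine ((integrable_const (1 : ℝ)).add (hint s)).mono' (hem s).aestronglyMeasurable
      (ae_of_all _ fun ω => ?_)
    have := rpow_le_one_add_rpow (abs_nonneg (e s ω)) (by norm_num : (0 : ℝ) ≤ 1)
      (by linarith : 1 ≤ p)
    simpa using this
  -- the coefficients of the second-order expansion
  set c : ℕ → Ω → ℝ := fun s ω => (logNorm p (T (s + 1) ω))⁻¹ with hc
  have hcpos : ∀ s ω, 0 < c s ω := fun s ω => inv_pos.2 (logNorm_pos _ _)
  have hcle : ∀ s ω, c s ω ≤ (logNorm p 0)⁻¹ := fun s ω =>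
    inv_anti₀ (logNorm_pos _ _) (logNorm_mono hp2.le (Nat.zero_le _))
  -- The counter after the next round is already known at time `s`, so the new normalization acts as
  -- a constant when averaging over `e s`.
  have hcmeas : ∀ s, Measurable[𝓕 s] (c s) := fun s =>
    (measurable_from_top (f := fun k => (logNorm p k)⁻¹)).comp (hTm s)
  set V : ℕ → Ω → ℝ := fun s ω => c s ω * (p * (|S s ω| ^ (p - 2) * S s ω) * w s ω) with hV
  set W : ℕ → Ω → ℝ := fun s ω => c s ω * (2 * p * |S s ω| ^ (p - 2) * (w s ω) ^ 2) with hW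
  set Q : ℕ → Ω → ℝ := fun s ω => c s ω * (2 * p * |w s ω| ^ p) with hQ
  have habs : ∀ s, Measurable[𝓕 s] fun ω => |S s ω| := fun s =>
    continuous_abs.measurable.comp (hSm s)
  have hVm : ∀ s, Measurable[𝓕 s] (V s) := fun s =>
    (hcmeas s).mul (((((habs s).pow_const _).mul (hSm s)).const_mul p).mul (hw s))
  have hWm : ∀ s, Measurable[𝓕 s] (W s) := fun s =>
    (hcmeas s).mul ((((habs s).pow_const _).const_mul _).mul ((hw s).pow_const 2))
  have hQm : ∀ s, Measurable[𝓕 s] (Q s) := fun s =>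
    (hcmeas s).mul (((continuous_abs.measurable.comp (hw s)).pow_const _).const_mul _)
  have hexp : ∀ s ω, c s ω * |S (s + 1) ω| ^ p ≤ c s ω * |S s ω| ^ p + V s ω * e s ω
      + W s ω * (e s ω) ^ 2 + Q s ω * |e s ω| ^ p := by
    intro s ω
    have h := mul_le_mul_of_nonneg_left
      (abs_add_rpow_le hp2.le hp3 (S s ω) (w s ω * e s ω)) (hcpos s ω).le
    rw [hSsucc]
    refine h.trans (le_of_eq ?_)
    rw [abs_mul, Real.mul_rpow (abs_nonneg _) (abs_nonneg _)]
    simp only [hV, hW, hQ]; ring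
  set c₀ := (logNorm p 0)⁻¹ with hc₀
  have hc₀0 : 0 ≤ c₀ := inv_nonneg.2 (logNorm_pos _ _).le
  have hVi : ∀ s, Integrable (fun ω => |S s ω| ^ p) P → Integrable (V s) P := by
    intro s hi
    refine (((integrable_const (1 : ℝ)).add hi).const_mul (c₀ * (p * B))).mono'
      ((hVm s).mono (𝓕.le s) le_rfl).aestronglyMeasurable (ae_of_all _ fun ω => ?_)
    have h1 : |(|S s ω| ^ (p - 2) * S s ω)| ≤ 1 + |S s ω| ^ p := by
      rcases abs_rpow_sub_two_mul_self p (S s ω) with h | h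
      · rw [h]; exact rpow_le_one_add_rpow (abs_nonneg _) (by linarith) (by linarith)
      · rw [h, mul_zero, abs_zero]; positivity
    simp only [hV, Real.norm_eq_abs, abs_mul (c s ω), abs_of_pos (hcpos s ω), abs_mul _ (w s ω),
      abs_mul p, abs_of_pos hp0, Pi.add_apply]
    calc c s ω * (p * |(|S s ω| ^ (p - 2) * S s ω)| * |w s ω|)
        ≤ c₀ * (p * (1 + |S s ω| ^ p) * B) := by
          gcongr
          · exact hcle s ω
          · exact hwB s ω
      _ = _ := by ring
  have hWi : ∀ s, Integrable (fun ω => |S s ω| ^ p) P → Integrable (W s) P := by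
    intro s hi
    refine (((integrable_const (1 : ℝ)).add hi).const_mul (c₀ * (2 * p * B ^ 2))).mono'
      ((hWm s).mono (𝓕.le s) le_rfl).aestronglyMeasurable (ae_of_all _ fun ω => ?_)
    have h1 : |S s ω| ^ (p - 2) ≤ 1 + |S s ω| ^ p :=
      rpow_le_one_add_rpow (abs_nonneg _) (by linarith) (by linarith)
    have h0 : 0 ≤ W s ω := by have := hcpos s ω; simp only [hW]; positivity
    rw [Real.norm_eq_abs, abs_of_nonneg h0]
    simp only [hW, Pi.add_apply]
    rw [← sq_abs (w s ω)]
    calc c s ω * (2 * p * |S s ω| ^ (p - 2) * |w s ω| ^ 2)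
        ≤ c₀ * (2 * p * (1 + |S s ω| ^ p) * B ^ 2) := by
          gcongr
          · exact hcle s ω
          · exact hwB s ω
      _ = _ := by ring
  have hQi : ∀ s, Integrable (Q s) P := by
    intro s
    refine (integrable_const (c₀ * (2 * p * B ^ p))).mono'
      ((hQm s).mono (𝓕.le s) le_rfl).aestronglyMeasurable (ae_of_all _ fun ω => ?_)
    have h0 : 0 ≤ Q s ω := by have := hcpos s ω; simp only [hQ]; positivity
    rw [Real.norm_eq_abs, abs_of_nonneg h0]
    simp only [hQ]
    gcongr
    · exact hcle s ω
    · exact hwB s ω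
  have hVe := fun s hi => Indep.integrable_mul_and_setIntegral_mul (𝓕.le s) (hind s) (hVm s) (hcm s)
    (hVi s hi) (he1 s)
  have hWe := fun s hi => Indep.integrable_mul_and_setIntegral_mul (𝓕.le s) (hind s) (hWm s)
    ((hcm s).pow_const 2) (hWi s hi) (he2 s)
  have hQe := fun s => Indep.integrable_mul_and_setIntegral_mul (𝓕.le s) (hind s) (hQm s)
    ((continuous_abs.measurable.comp (hcm s)).pow_const p) (hQi s) (hint s)
  have hfm : ∀ s, Measurable[𝓕 s] fun ω => |S s ω| ^ p := fun s => (habs s).pow_const p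
  have hci : ∀ s, Integrable (fun ω => |S s ω| ^ p) P →
      Integrable (fun ω => c s ω * |S s ω| ^ p) P := by
    intro s hi
    refine hi.bdd_mul (c := c₀) ((hcmeas s).mono (𝓕.le s) le_rfl).aestronglyMeasurable
      (ae_of_all _ fun ω => ?_)
    rw [Real.norm_eq_abs, abs_of_pos (hcpos s ω)]; exact hcle s ω
  have hTle : ∀ s ω, T s ω ≤ s := by
    intro s ω
    induction s with
    | zero => rw [hT0]
    | succ s ih => rcases hT s ω with h | h <;> omega
  -- The same expansion gives integrability by induction: `T (s + 1) ≤ s + 1` bounds `c s` below by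
  -- a deterministic constant, which can be divided out.
  have hSi : ∀ s, Integrable (fun ω => |S s ω| ^ p) P := by
    intro s
    induction s with
    | zero => simp [hS, Real.zero_rpow hp0.ne']
    | succ s ih =>
      refine (((((hci s ih).add (hVe s ih).1).add (hWe s ih).1).add (hQe s).1).const_mul
        (logNorm p (s + 1))).mono' ((hfm (s + 1)).mono (𝓕.le _) le_rfl).aestronglyMeasurable
        (ae_of_all _ fun ω => ?_)
      have h0 : 0 ≤ |S (s + 1) ω| ^ p := by positivity
      have h1 : logNorm p (T (s + 1) ω) ≤ logNorm p (s + 1) := logNorm_mono hp2.le (hTle _ _)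
      have h2 : 1 ≤ logNorm p (s + 1) * c s ω := by
        rw [← div_eq_mul_inv, le_div_iff₀ (logNorm_pos _ _), one_mul]; exact h1
      rw [Real.norm_eq_abs, abs_of_nonneg h0]
      calc |S (s + 1) ω| ^ p ≤ logNorm p (s + 1) * c s ω * |S (s + 1) ω| ^ p :=
            le_mul_of_one_le_left h0 h2
        _ ≤ _ := by
            rw [mul_assoc]
            exact mul_le_mul_of_nonneg_left (hexp s ω) (logNorm_pos _ _).le
  -- The remaining budget compensates the upward drift of the normalized `p`-th power, making the
  -- sum a nonnegative supermartingale.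
  set Z : ℕ → Ω → ℝ := fun s ω => |S s ω| ^ p / logNorm p (T s ω) + C * logBudget p (T s ω) with hZ
  have hZ0 : ∀ s ω, 0 ≤ Z s ω := fun s ω => by
    have h1 := logNorm_pos p (T s ω)
    have h2 := logBudget_nonneg p (T s ω)
    simp only [hZ]; positivity
  have hZm : ∀ s, Measurable[𝓕 s] (Z s) := fun s =>
    ((hfm s).div ((measurable_from_top (f := logNorm p)).comp (hTm' s))).add
      (((measurable_from_top (f := logBudget p)).comp (hTm' s)).const_mul C)
  have hbi : ∀ s, Integrable (fun ω => logBudget p (T s ω)) P := by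
    intro s
    refine (integrable_const (logBudget p 0)).mono' (((measurable_from_top (f := logBudget p)).comp
      (hTm' s)).mono (𝓕.le s) le_rfl).aestronglyMeasurable (ae_of_all _ fun ω => ?_)
    rw [Real.norm_eq_abs, abs_of_nonneg (logBudget_nonneg _ _)]
    exact logBudget_anti hp2 (Nat.zero_le _)
  have hZi : ∀ s, Integrable (Z s) P := by
    intro s
    refine Integrable.add ?_ ((hbi s).const_mul C)
    refine ((hSi s).const_mul c₀).mono' (((hfm s).div ((measurable_from_top (f := logNorm p)).comp
      (hTm' s))).mono (𝓕.le s) le_rfl).aestronglyMeasurable (ae_of_all _ fun ω => ?_)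
    have h1 := logNorm_pos p (T s ω)
    rw [Real.norm_eq_abs, abs_of_nonneg (by positivity), div_eq_inv_mul]
    gcongr
    exact inv_anti₀ (logNorm_pos _ _) (logNorm_mono hp2.le (Nat.zero_le _))
  have hstep : ∀ s ω, c s ω * |S s ω| ^ p + W s ω * (∫ ω, (e s ω) ^ 2 ∂P)
      + Q s ω * (∫ ω, |e s ω| ^ p ∂P) + C * logBudget p (T (s + 1) ω) ≤ Z s ω := by
    intro s ω
    -- In an idle round weight and drift vanish and equality holds; in an active round the budget
    -- pays.
    rcases hT s ω with ⟨h1, h2⟩ | h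
    · simp only [hW, hQ, hc, hZ, h1, h2]
      rw [abs_zero, Real.zero_rpow hp0.ne']
      apply le_of_eq; ring
    · have h3 := hC (T s ω) (S s ω) (w s ω) _ _ (hwB s ω) (he2K s)
        ((hK s).trans (by linarith : K ≤ 1 + K))
      simp only [hW, hQ, hc, hZ, h]
      refine le_trans (le_of_eq ?_) h3
      rw [div_eq_inv_mul]; ring
  have hsuper : Supermartingale Z 𝓕 P := by
    refine supermartingale_of_setIntegral_succ_le (fun s => (hZm s).stronglyMeasurable) hZi
      fun s A hA => ?_
    have hi := hSi s
    have h1 : ∫ ω in A, Z (s + 1) ω ∂P ≤ ∫ ω in A, ((c s ω * |S s ω| ^ p + V s ω * e s ω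
        + W s ω * (e s ω) ^ 2 + Q s ω * |e s ω| ^ p) + C * logBudget p (T (s + 1) ω)) ∂P := by
      refine integral_mono (hZi _).integrableOn (((((hci s hi).add (hVe s hi).1).add
        (hWe s hi).1).add (hQe s).1).add ((hbi (s + 1)).const_mul C)).integrableOn fun ω => ?_
      have := hexp s ω
      simp only [hZ]
      rw [div_eq_inv_mul]
      linarith
    have h2 : ∫ ω in A, ((c s ω * |S s ω| ^ p + V s ω * e s ω
        + W s ω * (e s ω) ^ 2 + Q s ω * |e s ω| ^ p) + C * logBudget p (T (s + 1) ω)) ∂P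
        = ∫ ω in A, (c s ω * |S s ω| ^ p + W s ω * (∫ ω, (e s ω) ^ 2 ∂P)
      + Q s ω * (∫ ω, |e s ω| ^ p ∂P) + C * logBudget p (T (s + 1) ω)) ∂P := by
      have i1 := (hci s hi).integrableOn (s := A)
      have i2 := (hVe s hi).1.integrableOn (s := A)
      have i3 := (hWe s hi).1.integrableOn (s := A)
      have i5 := ((hbi (s + 1)).const_mul C).integrableOn (s := A)
      have i6 := ((hWi s hi).mul_const (∫ ω, (e s ω) ^ 2 ∂P)).integrableOn (s := A)
      have i7 := ((hQi s).mul_const (∫ ω, |e s ω| ^ p ∂P)).integrableOn (s := A)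
      have i4 : IntegrableOn (fun ω => Q s ω * |e s ω| ^ p) A P := (hQe s).1.integrableOn
      have i12 : IntegrableOn (fun ω => c s ω * |S s ω| ^ p + V s ω * e s ω) A P := i1.add i2
      have i123 : IntegrableOn (fun ω => c s ω * |S s ω| ^ p + V s ω * e s ω
        + W s ω * (e s ω) ^ 2) A P := i12.add i3
      have i1234 : IntegrableOn (fun ω => c s ω * |S s ω| ^ p + V s ω * e s ω
        + W s ω * (e s ω) ^ 2 + Q s ω * |e s ω| ^ p) A P := i123.add i4
      have i16 : IntegrableOn (fun ω => c s ω * |S s ω| ^ p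
        + W s ω * (∫ ω, (e s ω) ^ 2 ∂P)) A P := i1.add i6
      have i167 : IntegrableOn (fun ω => c s ω * |S s ω| ^ p + W s ω * (∫ ω, (e s ω) ^ 2 ∂P)
        + Q s ω * (∫ ω, |e s ω| ^ p ∂P)) A P := i16.add i7
      have hQA : ∫ ω in A, Q s ω * |e s ω| ^ p ∂P = (∫ ω in A, Q s ω ∂P) * ∫ ω, |e s ω| ^ p ∂P :=
        (hQe s).2 A hA
      -- The first-order term disappears because `e s` is centered and independent of the past; the
      -- others have their moments factored out.
      rw [integral_add i1234 i5, integral_add i123 i4, integral_add i12 i3, integral_add i1 i2,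
        integral_add i167 i5, integral_add i16 i7, integral_add i1 i6, (hVe s hi).2 A hA,
        (hWe s hi).2 A hA, hQA, hmean s, integral_mul_const, integral_mul_const, mul_zero, add_zero]
    refine h1.trans (h2.le.trans (integral_mono ?_ (hZi s).integrableOn fun ω => hstep s ω))
    exact ((((hci s hi).add ((hWi s hi).mul_const _)).add ((hQi s).mul_const _)).add
      ((hbi (s + 1)).const_mul C)).integrableOn
  filter_upwards [hsuper.ae_bddAbove hZ0] with ω ⟨R, hR⟩
  have hR0 : 0 ≤ R := (hZ0 0 ω).trans (hR 0)
  refine ⟨R ^ (2 / p), fun t => ?_⟩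
  have h1 := logNorm_pos p (T t ω)
  have h2 : |S t ω| ^ p ≤ R * logNorm p (T t ω) := by
    rw [← div_le_iff₀ h1]
    refine le_trans ?_ (hR t)
    simp only [hZ]
    have := mul_nonneg hC0 (logBudget_nonneg p (T t ω))
    linarith
  have hL : 0 ≤ ((T t ω : ℝ) + 2) * Real.log (T t ω + 2) := by
    have := log_add_two_pos (T t ω); positivity
  have h3 := Real.rpow_le_rpow (by positivity) h2 (by positivity : 0 ≤ 2 / p)
  rw [← Real.rpow_mul (abs_nonneg _), Real.mul_rpow hR0 h1.le, logNorm, ← Real.rpow_mul hL,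
    mul_div_cancel₀ _ hp0.ne', show p / 2 * (2 / p) = 1 by field_simp, Real.rpow_one] at h3
  have h4 : |S t ω| ^ (2 : ℝ) = (S t ω) ^ 2 := by
    rw [← sq_abs]; exact_mod_cast Real.rpow_natCast |S t ω| 2
  rw [h4] at h3
  exact h3

/-! ### Best responses for strongly convex costs. -/

namespace RAID

theorem hasDerivAt_dotProduct_basis {d : ℕ} (θ : Fin d → ℝ) (x : ℝ) :
    HasDerivAt (fun x => θ ⬝ᵥ basis d x) (θ ⬝ᵥ gradBasis d x) x := by
  simp only [dotProduct, gradBasis_apply]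
  refine HasDerivAt.fun_sum fun k _ => HasDerivAt.const_mul _ ?_
  simpa [basis] using hasDerivAt_pow (k.val + 1) x

theorem hasDerivAt_dotProduct_gradBasis {d : ℕ} (θ : Fin d → ℝ) (x : ℝ) :
    HasDerivAt (fun x => θ ⬝ᵥ gradBasis d x) (θ ⬝ᵥ hessBasis d x) x := by
  simp only [dotProduct, gradBasis_apply, hessBasis_apply]
  exact HasDerivAt.fun_sum fun k _ => ((hasDerivAt_pow k.val x).const_mul _).const_mul _

theorem continuous_gradBasis (d : ℕ) : Continuous (gradBasis d) := by
  refine continuous_pi fun k => ?_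
  simp only [gradBasis_apply]
  fun_prop

variable {d : ℕ} {lo hi m M : ℝ} {θ : Fin d → ℝ} {br : ℝ → ℝ}

/-- The marginal cost of an admissible type is strongly monotone. -/
theorem mul_sq_le_of_admissible (hθ : θ ∈ admissibleTypes (Set.Icc lo hi) m M) {x y : ℝ}
    (hx : x ∈ Set.Icc lo hi) (hy : y ∈ Set.Icc lo hi) :
    m * (y - x) ^ 2 ≤ (θ ⬝ᵥ gradBasis d y - θ ⬝ᵥ gradBasis d x) * (y - x) := by
  have key : ∀ x ∈ Set.Icc lo hi, ∀ y ∈ Set.Icc lo hi, x ≤ y →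
      m * (y - x) ≤ θ ⬝ᵥ gradBasis d y - θ ⬝ᵥ gradBasis d x :=
    (convex_Icc lo hi).mul_sub_le_image_sub_of_le_deriv
      (fun x _ => (hasDerivAt_dotProduct_gradBasis θ x).continuousAt.continuousWithinAt)
      (fun x _ => (hasDerivAt_dotProduct_gradBasis θ x).differentiableAt.differentiableWithinAt)
      (fun x hx => by
        rw [(hasDerivAt_dotProduct_gradBasis θ x).deriv]
        exact (hθ x (interior_subset hx)).1)
  rcases le_total x y with h | h
  · nlinarith [mul_le_mul_of_nonneg_right (key x hx y hy h) (sub_nonneg.2 h)]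
  · nlinarith [mul_le_mul_of_nonneg_right (key y hy x hx h) (sub_nonneg.2 h)]

/-- The first-order optimality condition of a best response. -/
theorem IsBestResponse.variational (hbr : IsBestResponse (Set.Icc lo hi) θ br) (p : ℝ) {y : ℝ}
    (hy : y ∈ Set.Icc lo hi) : 0 ≤ (θ ⬝ᵥ gradBasis d (br p) + p) * (y - br p) := by
  have hd : HasDerivAt (fun x => cost θ x p) (θ ⬝ᵥ gradBasis d (br p) + p) (br p) := by
    unfold cost
    simpa using (hasDerivAt_dotProduct_basis θ (br p)).fun_add
      ((hasDerivAt_id' (br p)).const_mul p)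
  have h := (hbr p).2.localize.hasFDerivWithinAt_nonneg hd.hasFDerivAt.hasFDerivWithinAt
    (sub_mem_posTangentConeAt_of_segment_subset ((convex_Icc lo hi).segment_subset (hbr p).1 hy))
  simpa [mul_comm] using h

/-- Each response is tested in the optimality condition of the other. The sum, with strong
monotonicity, gives `m |Δx|² ≤ |Δp| |Δx|`. -/
theorem IsBestResponse.mul_abs_sub_le (hbr : IsBestResponse (Set.Icc lo hi) θ br)
    (hθ : θ ∈ admissibleTypes (Set.Icc lo hi) m M) (p q : ℝ) :
    m * |br p - br q| ≤ |p - q| := by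
  have h1 := hbr.variational p (hbr q).1
  have h2 := hbr.variational q (hbr p).1
  have h3 := mul_sq_le_of_admissible hθ (hbr p).1 (hbr q).1
  have h4 : m * (br q - br p) ^ 2 ≤ (p - q) * (br q - br p) := by nlinarith
  rcases eq_or_ne (br p) (br q) with h | h
  · rw [h]; simp
  have h5 : (p - q) * (br q - br p) ≤ |p - q| * |br p - br q| := by
    rw [abs_sub_comm (br p), ← abs_mul]; exact le_abs_self _
  have h6 : 0 < |br p - br q| := abs_pos.2 (sub_ne_zero.2 h)
  refine le_of_mul_le_mul_right (a := |br p - br q|) ?_ h6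
  calc m * |br p - br q| * |br p - br q| = m * (br q - br p) ^ 2 := by
        rw [← sq_abs (br q - br p), abs_sub_comm (br q)]; ring
    _ ≤ _ := h4.trans h5

theorem IsBestResponse.continuous (hbr : IsBestResponse (Set.Icc lo hi) θ br)
    (hθ : θ ∈ admissibleTypes (Set.Icc lo hi) m M) (hm : 0 < m) : Continuous br := by
  refine (LipschitzWith.of_dist_le_mul (K := ⟨m⁻¹, by positivity⟩) fun p q => ?_).continuous
  have := hbr.mul_abs_sub_le hθ p q
  rw [Real.dist_eq, Real.dist_eq]
  change _ ≤ m⁻¹ * _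
  rw [inv_mul_eq_div, le_div_iff₀ hm]; linarith

/-- Every strategy is the best response to the opposite of its marginal cost. -/
theorem IsBestResponse.eq_of_neg_marginal (hbr : IsBestResponse (Set.Icc lo hi) θ br)
    (hθ : θ ∈ admissibleTypes (Set.Icc lo hi) m M) (hm : 0 < m) {x : ℝ}
    (hx : x ∈ Set.Icc lo hi) : br (-(θ ⬝ᵥ gradBasis d x)) = x := by
  have h1 := hbr.variational (-(θ ⬝ᵥ gradBasis d x)) hx
  have h2 := mul_sq_le_of_admissible hθ (hbr (-(θ ⬝ᵥ gradBasis d x))).1 hx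
  have h3 : (x - br (-(θ ⬝ᵥ gradBasis d x))) ^ 2 = 0 := by
    refine le_antisymm ?_ (sq_nonneg _)
    nlinarith
  nlinarith [pow_eq_zero_iff (two_ne_zero) |>.1 h3]

/-- At an interior best response the marginal cost balances the incentive. -/
theorem IsBestResponse.marginal_eq (hbr : IsBestResponse (Set.Icc lo hi) θ br) {p : ℝ}
    (hp : br p ∈ interior (Set.Icc lo hi)) : θ ⬝ᵥ gradBasis d (br p) = -p := by
  rw [interior_Icc] at hp
  -- The two endpoints lie on opposite sides of an interior response and force opposite signs.
  have h1 := hbr.variational p (y := lo) ⟨le_rfl, (hp.1.trans hp.2).le⟩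
  have h2 := hbr.variational p (y := hi) ⟨(hp.1.trans hp.2).le, le_rfl⟩
  have h3 := hp.1
  have h4 := hp.2
  have h5 : θ ⬝ᵥ gradBasis d (br p) + p ≤ 0 := by
    by_contra h; push Not at h; nlinarith
  have h6 : 0 ≤ θ ⬝ᵥ gradBasis d (br p) + p := by
    by_contra h; push Not at h; nlinarith
  linarith

end RAID

/-! ### Rank-one updates and trace bounds for positive matrices. -/

theorem Matrix.trace_mul_vecMulVec_mul {d : ℕ} (S : Matrix (Fin d) (Fin d) ℝ)
    (hS : S.IsHermitian) (ξ : Fin d → ℝ) :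
    (S * vecMulVec ξ ξ * S).trace = (S *ᵥ ξ) ⬝ᵥ (S *ᵥ ξ) := by
  have h : Sᵀ = S := by simpa [Matrix.IsHermitian, conjTranspose_eq_transpose_of_trivial] using hS
  rw [mul_vecMulVec, vecMulVec_mul, trace_vecMulVec, ← mulVec_transpose, h]

/-- The Sherman–Morrison formula in the form of the recursive least-squares update. -/
theorem Matrix.inv_add_smul_vecMulVec {d : ℕ} {J : Matrix (Fin d) (Fin d) ℝ} (hJ : J.PosDef)
    {δ : ℝ} (hδ : 0 ≤ δ) (ξ : Fin d → ℝ) :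
    (J + δ • vecMulVec ξ ξ)⁻¹
      = J⁻¹ - (δ / (1 + δ * (ξ ⬝ᵥ J⁻¹ *ᵥ ξ))) • (J⁻¹ * vecMulVec ξ ξ * J⁻¹) := by
  have hdet : IsUnit J.det := (Matrix.isUnit_iff_isUnit_det _).1 hJ.isUnit
  have h1 : J⁻¹ * J = 1 := Matrix.nonsing_inv_mul _ hdet
  have hq : 0 ≤ ξ ⬝ᵥ J⁻¹ *ᵥ ξ := by simpa using hJ.inv.posSemidef.dotProduct_mulVec_nonneg ξ
  set q := ξ ⬝ᵥ J⁻¹ *ᵥ ξ with hqd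
  have hpos : 0 < 1 + δ * q := by positivity
  refine Matrix.inv_eq_left_inv ?_
  have h2 : vecMulVec ξ ξ * J⁻¹ * vecMulVec ξ ξ = q • vecMulVec ξ ξ := by
    rw [Matrix.mul_assoc, mul_vecMulVec, vecMulVec_mul_vecMulVec]
    rw [hqd]
    ext i j; simp [vecMulVec_apply]; ring
  have h3 : J⁻¹ * vecMulVec ξ ξ * J⁻¹ * J = J⁻¹ * vecMulVec ξ ξ := by
    rw [Matrix.mul_assoc _ J⁻¹ J, h1, Matrix.mul_one]
  have h4 : J⁻¹ * vecMulVec ξ ξ * J⁻¹ * vecMulVec ξ ξ = q • (J⁻¹ * vecMulVec ξ ξ) := by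
    rw [Matrix.mul_assoc J⁻¹, Matrix.mul_assoc J⁻¹, h2, Matrix.mul_smul]
  rw [Matrix.sub_mul, Matrix.mul_add, h1, Matrix.mul_smul, Matrix.smul_mul, Matrix.mul_add, h3,
    Matrix.mul_smul, h4, smul_smul]
  generalize J⁻¹ * vecMulVec ξ ξ = X
  have h5 : δ - δ / (1 + δ * q) * (1 + δ * q) = 0 := by
    rw [div_mul_cancel₀ _ hpos.ne', sub_self]
  calc _ = 1 + (δ - δ / (1 + δ * q) * (1 + δ * q)) • X := by module
    _ = 1 := by rw [h5, zero_smul, add_zero]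

/-- A lower bound on a positive definite quadratic form bounds the trace of the inverse. -/
theorem Matrix.PosDef.trace_inv_le {d : ℕ} {J : Matrix (Fin d) (Fin d) ℝ} (hJ : J.PosDef)
    {r : ℝ} (hr : 0 < r) (h : ∀ v : Fin d → ℝ, r * (v ⬝ᵥ v) ≤ v ⬝ᵥ J *ᵥ v) :
    J⁻¹.trace ≤ d / r := by
  have hdet : IsUnit J.det := (Matrix.isUnit_iff_isUnit_det _).1 hJ.isUnit
  have key : ∀ k, J⁻¹ k k ≤ 1 / r := by
    intro k
    -- The form is tested at the `k`-th column `v` of the inverse: its value there is `v k`, so `r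
    -- (v k)² ≤ v k`.
    set v := J⁻¹ *ᵥ Pi.single k 1 with hv
    have hJv : J *ᵥ v = Pi.single k 1 := by
      rw [hv, mulVec_mulVec, Matrix.mul_nonsing_inv _ hdet, one_mulVec]
    have hvk : v k = J⁻¹ k k := by simp [hv]
    have h1 := h v
    rw [hJv, dotProduct_single, mul_one] at h1
    have h2 : v k * v k ≤ v ⬝ᵥ v :=
      Finset.single_le_sum (f := fun i => v i * v i) (fun i _ => mul_self_nonneg _)
        (Finset.mem_univ k)
    have h3 : r * (v k * v k) ≤ v k := (mul_le_mul_of_nonneg_left h2 hr.le).trans h1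
    have h4 : 0 < v k := by rw [hvk]; exact hJ.inv.diag_pos
    rw [← hvk, le_div_iff₀ hr]
    nlinarith
  calc J⁻¹.trace = ∑ k, J⁻¹ k k := rfl
    _ ≤ ∑ _k : Fin d, 1 / r := Finset.sum_le_sum fun k _ => key k
    _ = d / r := by simp [div_eq_mul_inv]

/-- Testing at `e_k ± e_l` gives `2 |S k l| ≤ S k k + S l l`. -/
theorem Matrix.PosSemidef.abs_apply_le_trace {d : ℕ} {S : Matrix (Fin d) (Fin d) ℝ}
    (hS : S.PosSemidef) (k l : Fin d) : |S k l| ≤ S.trace := by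
  have hdiag : ∀ k, 0 ≤ S k k := fun k => hS.diag_nonneg
  have hle : ∀ k, S k k ≤ S.trace := fun k =>
    Finset.single_le_sum (f := fun i => S i i) (fun i _ => hdiag i) (Finset.mem_univ k)
  have hsym : S l k = S k l := by simpa using hS.isHermitian.apply k l
  have h1 := hS.dotProduct_mulVec_nonneg (Pi.single k 1 + Pi.single l 1)
  have h2 := hS.dotProduct_mulVec_nonneg (Pi.single k 1 - Pi.single l 1)
  simp [mulVec_add, mulVec_sub, dotProduct_add, dotProduct_sub, hsym] at h1 h2
  rw [abs_le]
  constructor <;> linarith [hle k, hle l]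

/-! ### The recursive estimator in closed form. -/

namespace RAID

theorem informative_nonneg (X : Set ℝ) (x : ℝ) : 0 ≤ informative X x :=
  Set.indicator_nonneg (fun _ _ => zero_le_one) x

theorem informative_le_one (X : Set ℝ) (x : ℝ) : informative X x ≤ 1 :=
  Set.indicator_le_self' (f := (1 : ℝ → ℝ)) (fun _ _ => zero_le_one) x

theorem measurable_informative (X : Set ℝ) : Measurable (informative X) :=
  measurable_one.indicator isOpen_interior.measurableSet

variable {d : ℕ}

open Classical in
/-- The number of exploration steps among the first `t` rounds. -/
noncomputable def Agent.explorations (g : Agent d) (γ : ℝ) (ε e : ℕ → ℝ) : ℕ → ℕ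
  | 0 => 0
  | t + 1 => g.explorations γ ε e t + if Explores γ t (g.state γ ε e t).cov then 1 else 0

open Classical in
/-- The weight of round `t + 1` in the estimator: `1` for an informative exploration step. -/
noncomputable def Agent.weight (g : Agent d) (γ : ℝ) (ε e : ℕ → ℝ) (t : ℕ) : ℝ :=
  if Explores γ t (g.state γ ε e t).cov then informative g.X (g.response γ ε e (t + 1)) else 0

/-- The regressor of round `t + 1`. -/
noncomputable def Agent.regressor (g : Agent d) (γ : ℝ) (ε e : ℕ → ℝ) (t : ℕ) : Fin d → ℝ :=
  gradBasis d (g.response γ ε e (t + 1))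

/-- The information matrix `Σ(t)⁻¹`. -/
noncomputable def Agent.information (g : Agent d) (γ : ℝ) (ε e : ℕ → ℝ) (t : ℕ) :
    Matrix (Fin d) (Fin d) ℝ :=
  g.cov₀⁻¹ + ∑ s ∈ Finset.range t,
    g.weight γ ε e s • vecMulVec (g.regressor γ ε e s) (g.regressor γ ε e s)

/-- The accumulated noise `∑ δ(s) e(s) ξ(s)`. -/
noncomputable def Agent.noiseSum (g : Agent d) (γ : ℝ) (ε e : ℕ → ℝ) (t : ℕ) : Fin d → ℝ :=
  ∑ s ∈ Finset.range t, (g.weight γ ε e s * e (s + 1)) • g.regressor γ ε e s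

variable (g : Agent d) (γ : ℝ) (ε e : ℕ → ℝ)

theorem Agent.weight_nonneg (t : ℕ) : 0 ≤ g.weight γ ε e t := by
  unfold Agent.weight
  split_ifs
  · exact informative_nonneg _ _
  · exact le_rfl

theorem Agent.weight_le_one (t : ℕ) : g.weight γ ε e t ≤ 1 := by
  unfold Agent.weight
  split_ifs
  · exact informative_le_one _ _
  · exact zero_le_one

theorem Agent.response_eq_of_explores {t : ℕ} (h : Explores γ t (g.state γ ε e t).cov) :
    g.response γ ε e (t + 1) = g.br (ε (t + 1)) := by
  simp [Agent.response, Agent.price, incentive, h]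

theorem Agent.response_eq_of_not_explores {t : ℕ} (h : ¬ Explores γ t (g.state γ ε e t).cov) :
    g.response γ ε e (t + 1) = g.br (-((g.state γ ε e t).est ⬝ᵥ gradBasis d g.xdes)) := by
  simp [Agent.response, Agent.price, incentive, h]

theorem Agent.state_succ_of_explores {t : ℕ} (h : Explores γ t (g.state γ ε e t).cov) :
    g.state γ ε e (t + 1) = lsUpdate g.X (g.state γ ε e t) (g.response γ ε e (t + 1))
      (observation g.θ (g.response γ ε e (t + 1)) (e (t + 1))) := by
  rw [Agent.state]
  simp only [h, if_true]
  rfl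

theorem Agent.state_succ_of_not_explores {t : ℕ} (h : ¬ Explores γ t (g.state γ ε e t).cov) :
    g.state γ ε e (t + 1) = g.state γ ε e t := by
  rw [Agent.state]
  simp only [h, if_false]

theorem Agent.information_succ (t : ℕ) : g.information γ ε e (t + 1) = g.information γ ε e t
    + g.weight γ ε e t • vecMulVec (g.regressor γ ε e t) (g.regressor γ ε e t) := by
  simp [Agent.information, Finset.sum_range_succ, add_assoc]

theorem posSemidef_vecMulVec_self (ξ : Fin d → ℝ) : (vecMulVec ξ ξ).PosSemidef := by
  simpa using posSemidef_vecMulVec_self_star ξ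

theorem Agent.posDef_information (h0 : g.cov₀.PosDef) (t : ℕ) :
    (g.information γ ε e t).PosDef := by
  induction t with
  | zero => simpa [Agent.information] using h0.inv
  | succ t ih =>
    rw [Agent.information_succ]
    exact ih.add_posSemidef ((posSemidef_vecMulVec_self _).smul (g.weight_nonneg γ ε e t))

/-- The recursion for `Σ` is Sherman–Morrison applied to an additive recursion for the information;
zero weight covers exploitation and boundary responses. -/
theorem Agent.cov_eq_inv (h0 : g.cov₀.PosDef) (t : ℕ) :
    (g.state γ ε e t).cov = (g.information γ ε e t)⁻¹ := by
  induction t with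
  | zero =>
    have : IsUnit g.cov₀.det := (Matrix.isUnit_iff_isUnit_det _).1 h0.isUnit
    simp [Agent.information, Agent.state, Matrix.nonsing_inv_nonsing_inv _ this]
  | succ t ih =>
    rw [Agent.information_succ, inv_add_smul_vecMulVec (g.posDef_information γ ε e h0 t)
      (g.weight_nonneg γ ε e t), ← ih]
    by_cases h : Explores γ t (g.state γ ε e t).cov
    · rw [g.state_succ_of_explores γ ε e h]
      simp only [lsUpdate, covUpdate, Agent.weight, h, if_true, Agent.regressor]
    · rw [g.state_succ_of_not_explores γ ε e h]
      simp [Agent.weight, h]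

theorem Agent.posDef_cov (h0 : g.cov₀.PosDef) (t : ℕ) : (g.state γ ε e t).cov.PosDef := by
  rw [g.cov_eq_inv γ ε e h0]; exact (g.posDef_information γ ε e h0 t).inv

theorem Agent.trace_cov_succ_le (h0 : g.cov₀.PosDef) (t : ℕ) :
    (g.state γ ε e (t + 1)).cov.trace ≤ (g.state γ ε e t).cov.trace := by
  by_cases h : Explores γ t (g.state γ ε e t).cov
  · rw [g.state_succ_of_explores γ ε e h]
    have hS := g.posDef_cov γ ε e h0 t
    simp only [lsUpdate, covUpdate, trace_sub, trace_smul,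
      trace_mul_vecMulVec_mul _ hS.isHermitian, smul_eq_mul]
    set ξ := gradBasis d (g.response γ ε e (t + 1))
    have h1 : 0 ≤ ξ ⬝ᵥ (g.state γ ε e t).cov *ᵥ ξ := by
      simpa using hS.posSemidef.dotProduct_mulVec_nonneg ξ
    have h2 := informative_nonneg g.X (g.response γ ε e (t + 1))
    have h3 : 0 ≤ ((g.state γ ε e t).cov *ᵥ ξ) ⬝ᵥ ((g.state γ ε e t).cov *ᵥ ξ) :=
      Finset.sum_nonneg fun i _ => mul_self_nonneg _
    have h4 := mul_nonneg (div_nonneg h2 (by positivity :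
      0 ≤ 1 + informative g.X (g.response γ ε e (t + 1)) * (ξ ⬝ᵥ (g.state γ ε e t).cov *ᵥ ξ))) h3
    linarith
  · rw [g.state_succ_of_not_explores γ ε e h]

/-- The normal equations for the estimation error. -/
theorem Agent.information_mulVec_error (h0 : g.cov₀.PosDef) (t : ℕ) :
    g.information γ ε e t *ᵥ (g.estimate γ ε e t - g.θ)
      = g.cov₀⁻¹ *ᵥ (g.est₀ - g.θ) - g.noiseSum γ ε e t := by
  induction t with
  | zero => simp [Agent.information, Agent.noiseSum, Agent.estimate, Agent.state]
  | succ t ih =>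
    have hn : g.noiseSum γ ε e (t + 1) = g.noiseSum γ ε e t
        + (g.weight γ ε e t * e (t + 1)) • g.regressor γ ε e t := by
      simp [Agent.noiseSum, Finset.sum_range_succ]
    rw [hn, ← sub_sub, ← ih]
    by_cases h : Explores γ t (g.state γ ε e t).cov
    · have hw : g.weight γ ε e t = informative g.X (g.response γ ε e (t + 1)) := by
        simp [Agent.weight, h]
      have hS : covUpdate g.X (g.state γ ε e t).cov (g.response γ ε e (t + 1))
          = (g.information γ ε e (t + 1))⁻¹ := by
        rw [← g.cov_eq_inv γ ε e h0 (t + 1), g.state_succ_of_explores γ ε e h]; rfl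
      have hdet : IsUnit (g.information γ ε e (t + 1)).det :=
        (Matrix.isUnit_iff_isUnit_det _).1 (g.posDef_information γ ε e h0 _).isUnit
      set ξ := g.regressor γ ε e t with hξ
      set η := g.estimate γ ε e t - g.θ with hη
      -- The innovation is `ξ·η + e`. Multiplying by the new information cancels the `ξ·η` part
      -- against the rank-one increment and leaves only the noise.
      have herr : g.estimate γ ε e (t + 1) - g.θ = η - (g.weight γ ε e t * (ξ ⬝ᵥ η + e (t + 1))) •
          ((g.information γ ε e (t + 1))⁻¹ *ᵥ ξ) := by
        have hobs : observation g.θ (g.response γ ε e (t + 1)) (e (t + 1))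
            + ξ ⬝ᵥ (g.state γ ε e t).est = ξ ⬝ᵥ η + e (t + 1) := by
          rw [hη, dotProduct_sub, observation, dotProduct_comm ξ g.θ, hξ]
          simp only [Agent.estimate, Agent.regressor]
          ring
        rw [Agent.estimate, g.state_succ_of_explores γ ε e h]
        simp only [lsUpdate]
        rw [hS, ← hw, ← hobs, hη, Agent.estimate, sub_right_comm]
        rfl
      rw [herr, mulVec_sub, mulVec_smul, mulVec_mulVec, Matrix.mul_nonsing_inv _ hdet, one_mulVec,
        g.information_succ, add_mulVec, smul_mulVec, vecMulVec_mulVec]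
      simp only [← hξ]
      ext i
      simp
      ring
    · have hw : g.weight γ ε e t = 0 := by simp [Agent.weight, h]
      rw [g.information_succ, hw, Agent.estimate, g.state_succ_of_not_explores γ ε e h]
      simp [Agent.estimate]

end RAID

/-! ### Number of explorations and rate of the estimator. -/

namespace RAID

theorem A_nonneg (γ : ℝ) (t : ℕ) : 0 ≤ A γ t :=
  mul_nonneg (Real.rpow_nonneg t.cast_nonneg _) (Real.log_natCast_nonneg t)

theorem A_mono {γ : ℝ} (hγ : 0 ≤ γ) : Monotone (A γ) := by
  intro s t hst
  rcases Nat.eq_zero_or_pos s with rfl | hs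
  · simpa [A] using A_nonneg γ t
  · have hs' : (0 : ℝ) < s := by exact_mod_cast hs
    have hst' : (s : ℝ) ≤ t := by exact_mod_cast hst
    have := Real.log_natCast_nonneg s
    unfold A
    gcongr

theorem isLittleO_A {γ : ℝ} (hγ : γ < 1) : A γ =o[atTop] fun t : ℕ => (t : ℝ) := by
  have h : (fun x : ℝ => x ^ γ * Real.log x) =o[atTop] fun x : ℝ => x := by
    refine ((isBigO_refl (fun x : ℝ => x ^ γ) atTop).mul_isLittleO
      (isLittleO_log_rpow_atTop (sub_pos.2 hγ))).congr' EventuallyEq.rfl ?_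
    filter_upwards [eventually_gt_atTop 0] with x hx
    rw [← Real.rpow_add hx]; simp
  exact h.comp_tendsto tendsto_natCast_atTop_atTop

theorem tendsto_A_atTop {γ : ℝ} (hγ : 0 < γ) : Tendsto (A γ) atTop atTop :=
  ((tendsto_rpow_atTop hγ).comp tendsto_natCast_atTop_atTop).atTop_mul_atTop₀
    (Real.tendsto_log_atTop.comp tendsto_natCast_atTop_atTop)

/-- Halving the time costs a factor `2^γ ≤ 2` in the power and a factor `2` in the logarithm, the
latter because `t ≥ 4`. -/
theorem A_le_four_mul {γ : ℝ} (hγ0 : 0 ≤ γ) (hγ1 : γ ≤ 1) {t u : ℕ} (ht : 4 ≤ t)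
    (hu : (t : ℝ) / 2 ≤ u) : A γ t ≤ 4 * A γ u := by
  have ht' : (4 : ℝ) ≤ t := by exact_mod_cast ht
  have h1 : (t : ℝ) ^ γ ≤ 2 * (u : ℝ) ^ γ := by
    have h2 : ((t : ℝ) / 2) ^ γ ≤ (u : ℝ) ^ γ := Real.rpow_le_rpow (by positivity) hu hγ0
    have h3 : (2 : ℝ) ^ γ ≤ 2 := by
      simpa using Real.rpow_le_rpow_of_exponent_le (by norm_num : (1 : ℝ) ≤ 2) hγ1
    rw [Real.div_rpow (by linarith) (by norm_num), div_le_iff₀ (by positivity)] at h2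
    have h4 : 0 ≤ (u : ℝ) ^ γ := by positivity
    nlinarith
  have h2 : Real.log t ≤ 2 * Real.log u := by
    have h3 : Real.log ((t : ℝ) / 2) ≤ Real.log u := Real.log_le_log (by linarith) hu
    rw [Real.log_div (by linarith) (by norm_num)] at h3
    have h4 : 2 * Real.log 2 ≤ Real.log t := by
      rw [← Real.log_rpow (by norm_num)]
      exact Real.log_le_log (by norm_num) (by norm_num; exact ht)
    linarith
  unfold A
  calc (t : ℝ) ^ γ * Real.log t ≤ (2 * (u : ℝ) ^ γ) * (2 * Real.log u) := by
        have := Real.log_natCast_nonneg t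
        gcongr
    _ = _ := by ring

variable {d : ℕ} (g : Agent d) (γ : ℝ) (ε e : ℕ → ℝ)

theorem Agent.explorations_succ_of_explores {t : ℕ} (h : Explores γ t (g.state γ ε e t).cov) :
    g.explorations γ ε e (t + 1) = g.explorations γ ε e t + 1 := by
  simp [Agent.explorations, h]

theorem Agent.explorations_succ_of_not_explores {t : ℕ}
    (h : ¬ Explores γ t (g.state γ ε e t).cov) :
    g.explorations γ ε e (t + 1) = g.explorations γ ε e t := by
  simp [Agent.explorations, h]

/-- In an exploring round `1 < A tr Σ`, hence `T + 1 ≤ A · tr Σ · (T + 1) ≤ K A`; the `+ 1` counts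
that very round. -/
theorem Agent.explorations_le_mul_A (hγ : 0 ≤ γ) {K : ℝ} (hK0 : 0 ≤ K)
    (hK : ∀ t, (g.state γ ε e t).cov.trace * (g.explorations γ ε e t + 1) ≤ K) (t : ℕ) :
    (g.explorations γ ε e t : ℝ) ≤ K * A γ t := by
  induction t with
  | zero => simp [Agent.explorations, A]
  | succ t ih =>
    have hmono := mul_le_mul_of_nonneg_left (A_mono hγ t.le_succ) hK0
    by_cases h : Explores γ t (g.state γ ε e t).cov
    · rw [g.explorations_succ_of_explores γ ε e h]
      refine le_trans ?_ hmono
      push_cast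
      have h1 : 1 < A γ t * (g.state γ ε e t).cov.trace := h
      have h2 : (0 : ℝ) ≤ (g.explorations γ ε e t : ℝ) + 1 := by positivity
      have h3 := mul_le_mul_of_nonneg_right h1.le h2
      have h4 := mul_le_mul_of_nonneg_left (hK t) (A_nonneg γ t)
      linarith
    · rw [g.explorations_succ_of_not_explores γ ε e h]
      exact ih.trans hmono

/-- Since the last exploitation step the trace test can have failed only in exploration steps. -/
theorem Agent.A_mul_trace_le_one (hγ : 0 ≤ γ) (h0 : g.cov₀.PosDef) (t : ℕ) :
    A γ (t - 1 - g.explorations γ ε e t) * (g.state γ ε e t).cov.trace ≤ 1 := by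
  induction t with
  | zero => simp [A]
  | succ t ih =>
    have htr : 0 ≤ (g.state γ ε e t).cov.trace :=
      Finset.sum_nonneg fun k _ => (g.posDef_cov γ ε e h0 t).posSemidef.diag_nonneg
    by_cases h : Explores γ t (g.state γ ε e t).cov
    · rw [g.explorations_succ_of_explores γ ε e h,
        show t + 1 - 1 - (g.explorations γ ε e t + 1) = t - 1 - g.explorations γ ε e t by omega]
      exact (mul_le_mul_of_nonneg_left (g.trace_cov_succ_le γ ε e h0 t) (A_nonneg _ _)).trans ih
    · rw [g.explorations_succ_of_not_explores γ ε e h, g.state_succ_of_not_explores γ ε e h]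
      have h1 : A γ t * (g.state γ ε e t).cov.trace ≤ 1 := not_lt.1 h
      refine (mul_le_mul_of_nonneg_right (A_mono hγ ?_) htr).trans h1
      omega

/-- The slack `2` serves both `t - 1 - T ≥ t/2` and `log (T + 2) ≤ log t`. -/
theorem Agent.eventually_explorations_add_two_le (hγ1 : γ < 1) {K : ℝ}
    (hT : ∀ t, (g.explorations γ ε e t : ℝ) ≤ K * A γ t) :
    ∀ᶠ t : ℕ in atTop, (g.explorations γ ε e t : ℝ) + 2 ≤ t / 2 := by
  have h1 : (fun t => K * A γ t) =o[atTop] fun t : ℕ => (t : ℝ) :=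
    (isLittleO_A hγ1).const_mul_left K
  filter_upwards [h1.bound (by norm_num : (0 : ℝ) < 1 / 4), eventually_ge_atTop 8] with t ht ht8
  have h8 : (8 : ℝ) ≤ t := by exact_mod_cast ht8
  rw [Real.norm_eq_abs, Real.norm_natCast] at ht
  have := (hT t).trans ((le_abs_self _).trans ht)
  linarith

theorem Agent.eventually_trace_mul_A_le (hγ0 : 0 ≤ γ) (hγ1 : γ < 1) (h0 : g.cov₀.PosDef) {K : ℝ}
    (hT : ∀ t, (g.explorations γ ε e t : ℝ) ≤ K * A γ t) :
    ∀ᶠ t : ℕ in atTop, (g.state γ ε e t).cov.trace * A γ t ≤ 4 := by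
  filter_upwards [g.eventually_explorations_add_two_le γ ε e hγ1 hT, eventually_ge_atTop 4]
    with t ht ht4
  have htr : 0 ≤ (g.state γ ε e t).cov.trace :=
    Finset.sum_nonneg fun k _ => (g.posDef_cov γ ε e h0 t).posSemidef.diag_nonneg
  have hle : g.explorations γ ε e t + 2 ≤ t := by
    have : ((g.explorations γ ε e t + 2 : ℕ) : ℝ) ≤ t := by
      push_cast; linarith [(Nat.cast_nonneg t : (0 : ℝ) ≤ t)]
    exact_mod_cast this
  have hu : (t : ℝ) / 2 ≤ ((t - 1 - g.explorations γ ε e t : ℕ) : ℝ) := by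
    have h2 : t = (t - 1 - g.explorations γ ε e t) + 1 + g.explorations γ ε e t := by omega
    have h3 : (t : ℝ) = ((t - 1 - g.explorations γ ε e t : ℕ) : ℝ) + 1
        + g.explorations γ ε e t := by exact_mod_cast h2
    linarith
  have h1 := A_le_four_mul hγ0 hγ1.le ht4 hu
  have h2 := g.A_mul_trace_le_one γ ε e hγ0 h0 t
  nlinarith [mul_le_mul_of_nonneg_left h1 htr]

theorem Agent.estimate_sub_eq (h0 : g.cov₀.PosDef) (t : ℕ) :
    g.estimate γ ε e t - g.θ
      = (g.state γ ε e t).cov *ᵥ (g.cov₀⁻¹ *ᵥ (g.est₀ - g.θ) - g.noiseSum γ ε e t) := by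
  have hdet : IsUnit (g.information γ ε e t).det :=
    (Matrix.isUnit_iff_isUnit_det _).1 (g.posDef_information γ ε e h0 t).isUnit
  rw [← g.information_mulVec_error γ ε e h0 t, g.cov_eq_inv γ ε e h0 t, mulVec_mulVec,
    Matrix.nonsing_inv_mul _ hdet, one_mulVec]

theorem norm_toLp_mulVec_sq_le {S : Matrix (Fin d) (Fin d) ℝ} (hS : S.PosSemidef)
    (y : Fin d → ℝ) : ‖WithLp.toLp 2 (S *ᵥ y)‖ ^ 2 ≤ d ^ 2 * S.trace ^ 2 * ∑ l, y l ^ 2 := by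
  have htr : ∀ k l, S k l ^ 2 ≤ S.trace ^ 2 := fun k l =>
    sq_le_sq' (neg_le_of_abs_le (hS.abs_apply_le_trace k l)) (le_of_abs_le (hS.abs_apply_le_trace k l))
  rw [EuclideanSpace.real_norm_sq_eq]
  have hrow : ∀ k, (S *ᵥ y) k ^ 2 ≤ d * S.trace ^ 2 * ∑ l, y l ^ 2 := by
    intro k
    calc (S *ᵥ y) k ^ 2 = (∑ l, S k l * y l) ^ 2 := rfl
      _ ≤ (∑ l, S k l ^ 2) * ∑ l, y l ^ 2 := Finset.sum_mul_sq_le_sq_mul_sq _ _ _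
      _ ≤ (∑ _l : Fin d, S.trace ^ 2) * ∑ l, y l ^ 2 := by
          refine mul_le_mul_of_nonneg_right (Finset.sum_le_sum fun l _ => htr k l)
            (Finset.sum_nonneg fun l _ => sq_nonneg _)
      _ = _ := by simp
  calc ∑ k, (S *ᵥ y) k ^ 2 ≤ ∑ _k : Fin d, d * S.trace ^ 2 * ∑ l, y l ^ 2 :=
        Finset.sum_le_sum fun k _ => hrow k
    _ = _ := by simp; ring

/-- The rate of the least-squares estimator, given enough information and few explorations. -/
theorem Agent.isBigO_estimate_sub (hγ0 : 0 < γ) (hγ1 : γ < 1) (h0 : g.cov₀.PosDef) {K C : ℝ}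
    (hC : 0 ≤ C) (hT : ∀ t, (g.explorations γ ε e t : ℝ) ≤ K * A γ t)
    (hnoise : ∀ t k, g.noiseSum γ ε e t k ^ 2
      ≤ C * (((g.explorations γ ε e t : ℝ) + 2) * Real.log (g.explorations γ ε e t + 2))) :
    (fun t : ℕ => ‖WithLp.toLp 2 (g.estimate γ ε e t - g.θ)‖ ^ 2)
      =O[atTop] fun t : ℕ => (t : ℝ) ^ (-γ) := by
  set b := g.cov₀⁻¹ *ᵥ (g.est₀ - g.θ) with hb
  set R := 2 * ∑ l, b l ^ 2 with hR
  have hR0 : 0 ≤ R := by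
    have := Finset.sum_nonneg fun l (_ : l ∈ Finset.univ) => sq_nonneg (b l)
    positivity
  -- `d²` comes from the entrywise matrix bound, `16` from the square of `tr Σ · A ≤ 4`, and the
  -- last factor from initial bias plus noise.
  refine IsBigO.of_bound (d ^ 2 * 16 * (R + 2 * d * C * (K + 2))) ?_
  filter_upwards [g.eventually_explorations_add_two_le γ ε e hγ1 hT,
    g.eventually_trace_mul_A_le γ ε e hγ0.le hγ1 h0 hT,
    (tendsto_A_atTop hγ0).eventually_ge_atTop 1, eventually_ge_atTop 3] with t h1 h2 h3 h4
  have ht3 : (3 : ℝ) ≤ t := by exact_mod_cast h4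
  have hlog : 1 ≤ Real.log t := by
    rw [Real.le_log_iff_exp_le (by linarith)]
    linarith [Real.exp_one_lt_d9]
  set τ := (g.state γ ε e t).cov.trace with hτ
  have htr : 0 ≤ τ :=
    Finset.sum_nonneg fun k _ => (g.posDef_cov γ ε e h0 t).posSemidef.diag_nonneg
  have hA : A γ t = (t : ℝ) ^ γ * Real.log t := rfl
  have hTn : (0 : ℝ) ≤ g.explorations γ ε e t := Nat.cast_nonneg _
  have hL : ((g.explorations γ ε e t : ℝ) + 2) * Real.log (g.explorations γ ε e t + 2)
      ≤ (K + 2) * A γ t * Real.log t := by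
    have h5 : (g.explorations γ ε e t : ℝ) + 2 ≤ (K + 2) * A γ t := by linarith [hT t]
    have h6 : Real.log (g.explorations γ ε e t + 2) ≤ Real.log t :=
      Real.log_le_log (by linarith) (by linarith)
    have h7 : 0 ≤ Real.log ((g.explorations γ ε e t : ℝ) + 2) := Real.log_nonneg (by linarith)
    exact mul_le_mul h5 h6 h7 ((by linarith : (0:ℝ) ≤ (g.explorations γ ε e t : ℝ) + 2).trans h5)
  have hy : ∑ l, (b - g.noiseSum γ ε e t) l ^ 2
      ≤ (R + 2 * d * C * (K + 2)) * (A γ t * Real.log t) := by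
    have h5 : ∀ l, (b - g.noiseSum γ ε e t) l ^ 2
        ≤ 2 * b l ^ 2 + 2 * (C * ((K + 2) * A γ t * Real.log t)) := by
      intro l
      have := (hnoise t l).trans (mul_le_mul_of_nonneg_left hL hC)
      rw [Pi.sub_apply]
      nlinarith [sq_nonneg (b l + g.noiseSum γ ε e t l)]
    have h6 : 1 ≤ A γ t * Real.log t := by nlinarith
    calc _ ≤ ∑ l, (2 * b l ^ 2 + 2 * (C * ((K + 2) * A γ t * Real.log t))) :=
          Finset.sum_le_sum fun l _ => h5 l
      _ = R + 2 * d * C * (K + 2) * (A γ t * Real.log t) := by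
          rw [Finset.sum_add_distrib, ← Finset.mul_sum]; simp [hR]; ring
      _ ≤ R * (A γ t * Real.log t) + 2 * d * C * (K + 2) * (A γ t * Real.log t) := by
          gcongr; exact le_mul_of_one_le_right hR0 h6
      _ = _ := by ring
  have hE := norm_toLp_mulVec_sq_le (g.posDef_cov γ ε e h0 t).posSemidef (b - g.noiseSum γ ε e t)
  rw [← g.estimate_sub_eq γ ε e h0 t] at hE
  -- No sign of `K` is assumed; nonnegativity is read off from `hy`, which bounds a sum of squares.
  have hQ0 : 0 ≤ R + 2 * d * C * (K + 2) := by
    by_contra hneg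
    push Not at hneg
    have h5 : 0 ≤ ∑ l, (b - g.noiseSum γ ε e t) l ^ 2 := Finset.sum_nonneg fun l _ => sq_nonneg _
    have h6 : 0 < A γ t * Real.log t := by positivity
    nlinarith
  have hpow : 0 < (t : ℝ) ^ (-γ) := by positivity
  -- The logarithm in `A` cancels exactly the logarithm of the noise bound: `log t = A t^(-γ)`.
  have hkey : τ ^ 2 * (A γ t * Real.log t) ≤ 16 * (t : ℝ) ^ (-γ) := by
    have hAt : A γ t * (t : ℝ) ^ (-γ) = Real.log t := by
      rw [hA, mul_right_comm, ← Real.rpow_add (by linarith)]; simp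
    have h5 : (τ * A γ t) ^ 2 ≤ 16 := by
      have : 0 ≤ τ * A γ t := by positivity
      nlinarith
    calc τ ^ 2 * (A γ t * Real.log t) = (τ * A γ t) ^ 2 * (t : ℝ) ^ (-γ) := by
          rw [← hAt]; ring
      _ ≤ _ := by gcongr
  rw [Real.norm_of_nonneg (by positivity), Real.norm_of_nonneg hpow.le]
  refine hE.trans ?_
  calc d ^ 2 * τ ^ 2 * ∑ l, (b - g.noiseSum γ ε e t) l ^ 2
      ≤ d ^ 2 * τ ^ 2 * ((R + 2 * d * C * (K + 2)) * (A γ t * Real.log t)) := by gcongr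
    _ = d ^ 2 * (R + 2 * d * C * (K + 2)) * (τ ^ 2 * (A γ t * Real.log t)) := by ring
    _ ≤ d ^ 2 * (R + 2 * d * C * (K + 2)) * (16 * (t : ℝ) ^ (-γ)) := by gcongr
    _ = _ := by ring

end RAID

/-! ### Regret of one agent. -/

namespace RAID

/-- Telescoping of `1/√(s+1) ≤ 2√(s+1) - 2√s`; the term `s = 0` is zero since `0⁻¹ = 0`. -/
theorem sum_range_inv_sqrt_le (t : ℕ) :
    ∑ s ∈ Finset.range t, (√(s : ℝ))⁻¹ ≤ 2 * √(t : ℝ) := by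
  have key : ∀ t : ℕ, ∑ s ∈ Finset.range (t + 1), (√(s : ℝ))⁻¹ ≤ 2 * √(t : ℝ) := by
    intro t
    induction t with
    | zero => simp
    | succ t ih =>
      rw [Finset.sum_range_succ]
      have h1 : 0 < √((t + 1 : ℕ) : ℝ) := Real.sqrt_pos.2 (by positivity)
      have h2 : (√(t : ℝ)) ^ 2 = t := Real.sq_sqrt (by positivity)
      have h3 : (√((t + 1 : ℕ) : ℝ)) ^ 2 = t + 1 := by
        rw [Real.sq_sqrt (by positivity)]; push_cast; ring
      have h4 := Real.sqrt_nonneg (t : ℝ)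
      have h5 : (√((t + 1 : ℕ) : ℝ))⁻¹ ≤ 2 * √((t + 1 : ℕ) : ℝ) - 2 * √(t : ℝ) := by
        rw [inv_eq_one_div, div_le_iff₀ h1]
        nlinarith [sq_nonneg (√((t + 1 : ℕ) : ℝ) - √(t : ℝ))]
      linarith
  refine le_trans ?_ (key t)
  exact Finset.sum_le_sum_of_subset_of_nonneg (Finset.range_mono t.le_succ)
    fun s _ _ => by positivity

variable {d : ℕ} (g : Agent d) (γ : ℝ) (ε e : ℕ → ℝ)

/-- The regret of an exploitation step is controlled by the estimation error. -/
theorem Agent.sq_response_sub_le {lo hi m M : ℝ} (hX : g.X = Set.Icc lo hi)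
    (hθ : g.θ ∈ admissibleTypes g.X m M) (hm : 0 < m) (hbr : IsBestResponse g.X g.θ g.br)
    (hdes : g.xdes ∈ g.X) {t : ℕ} (h : ¬ Explores γ t (g.state γ ε e t).cov) :
    (g.response γ ε e (t + 1) - g.xdes) ^ 2
      ≤ (m⁻¹ ^ 2 * ∑ k, gradBasis d g.xdes k ^ 2)
        * ‖WithLp.toLp 2 (g.estimate γ ε e t - g.θ)‖ ^ 2 := by
  rw [hX] at hθ hbr hdes
  have h1 := hbr.mul_abs_sub_le hθ (-((g.state γ ε e t).est ⬝ᵥ gradBasis d g.xdes))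
    (-(g.θ ⬝ᵥ gradBasis d g.xdes))
  -- The target is the response to the price computed from the true type, so only the price error
  -- remains.
  rw [hbr.eq_of_neg_marginal hθ hm hdes, ← g.response_eq_of_not_explores γ ε e h] at h1
  have h2 : -((g.state γ ε e t).est ⬝ᵥ gradBasis d g.xdes) - -(g.θ ⬝ᵥ gradBasis d g.xdes)
      = -((g.estimate γ ε e t - g.θ) ⬝ᵥ gradBasis d g.xdes) := by
    rw [sub_dotProduct, Agent.estimate]; ring
  rw [h2, abs_neg] at h1
  have h3 : ((g.estimate γ ε e t - g.θ) ⬝ᵥ gradBasis d g.xdes) ^ 2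
      ≤ (∑ k, (g.estimate γ ε e t - g.θ) k ^ 2) * ∑ k, gradBasis d g.xdes k ^ 2 :=
    Finset.sum_mul_sq_le_sq_mul_sq _ _ _
  have h4 : |g.response γ ε e (t + 1) - g.xdes|
      ≤ m⁻¹ * |(g.estimate γ ε e t - g.θ) ⬝ᵥ gradBasis d g.xdes| := by
    rw [inv_mul_eq_div, le_div_iff₀ hm]; linarith
  rw [EuclideanSpace.real_norm_sq_eq, ← sq_abs]
  calc |g.response γ ε e (t + 1) - g.xdes| ^ 2
      ≤ (m⁻¹ * |(g.estimate γ ε e t - g.θ) ⬝ᵥ gradBasis d g.xdes|) ^ 2 := by gcongr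
    _ = m⁻¹ ^ 2 * ((g.estimate γ ε e t - g.θ) ⬝ᵥ gradBasis d g.xdes) ^ 2 := by
        rw [mul_pow, sq_abs]
    _ ≤ m⁻¹ ^ 2 * ((∑ k, (g.estimate γ ε e t - g.θ) k ^ 2) * ∑ k, gradBasis d g.xdes k ^ 2) := by
        gcongr
    _ = _ := by ring

theorem Agent.response_mem (hbr : IsBestResponse g.X g.θ g.br) (t : ℕ) :
    g.response γ ε e t ∈ g.X := (hbr _).1

/-- The cumulative squared deviation of one agent is `O(t^γ log t)`. -/
theorem Agent.isBigO_sum_sq_response_sub {lo hi m M : ℝ} (hX : g.X = Set.Icc lo hi)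
    (hθ : g.θ ∈ admissibleTypes g.X m M) (hm : 0 < m) (hbr : IsBestResponse g.X g.θ g.br)
    (hdes : g.xdes ∈ g.X) (hγ : 1 / 2 ≤ γ) {K : ℝ}
    (hT : ∀ t, (g.explorations γ ε e t : ℝ) ≤ K * A γ t)
    (hest : (fun t : ℕ => ‖WithLp.toLp 2 (g.estimate γ ε e t - g.θ)‖ ^ 2)
      =O[atTop] fun t : ℕ => (t : ℝ) ^ (-γ)) :
    (fun t : ℕ => ∑ τ ∈ Finset.Icc 1 t, (g.response γ ε e τ - g.xdes) ^ 2) =O[atTop] A γ := by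
  obtain ⟨C, hC0, hC⟩ := hest.exists_nonneg
  obtain ⟨N, hN⟩ := eventually_atTop.1 hC.bound
  set c := m⁻¹ ^ 2 * ∑ k, gradBasis d g.xdes k ^ 2 with hc
  have hc0 : 0 ≤ c := mul_nonneg (sq_nonneg _) (Finset.sum_nonneg fun k _ => sq_nonneg _)
  set D := (hi - lo) ^ 2 with hD
  have hdiam : ∀ t, (g.response γ ε e t - g.xdes) ^ 2 ≤ D := by
    intro t
    have h1 := g.response_mem γ ε e hbr t
    rw [hX] at h1 hdes
    rw [← sq_abs]
    have : |g.response γ ε e t - g.xdes| ≤ hi - lo := by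
      rw [abs_le]; constructor <;> linarith [h1.1, h1.2, hdes.1, hdes.2]
    exact pow_le_pow_left₀ (abs_nonneg _) this 2
  have hbound : ∀ t : ℕ, ∑ s ∈ Finset.range t, (g.response γ ε e (s + 1) - g.xdes) ^ 2
      ≤ D * g.explorations γ ε e t + D * (N + 1) + c * C * ∑ s ∈ Finset.range t, (√(s : ℝ))⁻¹ := by
    intro t
    -- Three accounts: explorations at cost `D`, at most `N + 1` early rounds at cost `D`, and later
    -- exploitations at cost `t^(-γ) ≤ t^(-1/2)`. The `min` lets the early account close during the
    -- induction.
    have hsum : ∑ s ∈ Finset.range t, (g.response γ ε e (s + 1) - g.xdes) ^ 2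
        ≤ D * g.explorations γ ε e t + D * (min t (N + 1) : ℕ)
          + c * C * ∑ s ∈ Finset.range t, (√(s : ℝ))⁻¹ := by
      induction t with
      | zero => simp [Agent.explorations]
      | succ t ih =>
        rw [Finset.sum_range_succ, Finset.sum_range_succ]
        have hD0 : 0 ≤ D := sq_nonneg _
        have hinv : 0 ≤ c * C * (√(t : ℝ))⁻¹ := by positivity
        have hmin : D * (min t (N + 1) : ℕ) ≤ D * (min (t + 1) (N + 1) : ℕ) := by gcongr; omega
        by_cases h : Explores γ t (g.state γ ε e t).cov
        · rw [g.explorations_succ_of_explores γ ε e h]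
          push_cast at hmin ih ⊢
          linarith [hdiam (t + 1)]
        · rw [g.explorations_succ_of_not_explores γ ε e h]
          rcases lt_or_ge t (N + 1) with hlt | hge
          · rw [min_eq_left (by omega : t ≤ N + 1)] at ih
            rw [min_eq_left (by omega : t + 1 ≤ N + 1)]
            push_cast
            linarith [hdiam (t + 1)]
          · have h1 := g.sq_response_sub_le γ ε e hX hθ hm hbr hdes h
            have h2 := hN t (by omega)
            have ht1 : (1 : ℝ) ≤ t := by exact_mod_cast (by omega : 1 ≤ t)
            rw [Real.norm_of_nonneg (by positivity), Real.norm_of_nonneg (by positivity)] at h2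
            have h3 : (t : ℝ) ^ (-γ) ≤ (√(t : ℝ))⁻¹ := by
              rw [Real.sqrt_eq_rpow, ← Real.rpow_neg (by linarith)]
              exact Real.rpow_le_rpow_of_exponent_le ht1 (by linarith)
            have h4 : (g.response γ ε e (t + 1) - g.xdes) ^ 2 ≤ c * C * (√(t : ℝ))⁻¹ := by
              refine h1.trans ?_
              rw [mul_assoc c C]
              exact mul_le_mul_of_nonneg_left (h2.trans (mul_le_mul_of_nonneg_left h3 hC0)) hc0
            linarith
    refine hsum.trans ?_
    have : ((min t (N + 1) : ℕ) : ℝ) ≤ (N : ℝ) + 1 := by exact_mod_cast min_le_right t (N + 1)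
    have := mul_le_mul_of_nonneg_left this (sq_nonneg (hi - lo))
    linarith
  have hshift : ∀ t : ℕ, ∑ τ ∈ Finset.Icc 1 t, (g.response γ ε e τ - g.xdes) ^ 2
      = ∑ s ∈ Finset.range t, (g.response γ ε e (s + 1) - g.xdes) ^ 2 := by
    intro t
    rw [Finset.range_eq_Ico, Finset.sum_Ico_add' (fun τ => (g.response γ ε e τ - g.xdes) ^ 2) 0 t 1]
    rfl
  have hA0 : Tendsto (A γ) atTop atTop := tendsto_A_atTop (by linarith)
  refine IsBigO.of_bound (D * K + D * (N + 1) + c * C * 2) ?_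
  filter_upwards [hA0.eventually_ge_atTop 1, eventually_ge_atTop 3] with t h1 h3
  have ht3 : (3 : ℝ) ≤ t := by exact_mod_cast h3
  have hlog : 1 ≤ Real.log t := by
    rw [Real.le_log_iff_exp_le (by linarith)]
    linarith [Real.exp_one_lt_d9]
  rw [hshift, Real.norm_of_nonneg (Finset.sum_nonneg fun s _ => sq_nonneg _),
    Real.norm_of_nonneg (A_nonneg γ t)]
  have h4 : √(t : ℝ) ≤ A γ t := by
    rw [Real.sqrt_eq_rpow]
    calc (t : ℝ) ^ (1 / 2 : ℝ) ≤ (t : ℝ) ^ γ :=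
          Real.rpow_le_rpow_of_exponent_le (by linarith) hγ
      _ ≤ (t : ℝ) ^ γ * Real.log t := le_mul_of_one_le_right (by positivity) hlog
  have hD0 : 0 ≤ D := sq_nonneg _
  have h5 := mul_le_mul_of_nonneg_left (hT t) hD0
  have h6 := mul_le_mul_of_nonneg_left h1 (by positivity : 0 ≤ D * ((N : ℝ) + 1))
  have h7 := mul_le_mul_of_nonneg_left
    ((sum_range_inv_sqrt_le t).trans (mul_le_mul_of_nonneg_left h4 zero_le_two))
    (mul_nonneg hc0 hC0)
  linarith [hbound t]

end RAID

/-! ### Measurability of the algorithm. -/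

namespace RAID

variable {d : ℕ} {Ω : Type*}

theorem measurableSet_explores {mΩ : MeasurableSpace Ω} (γ : ℝ) (t : ℕ)
    {S : Ω → Matrix (Fin d) (Fin d) ℝ} (hS : ∀ k l, Measurable fun ω => S ω k l) :
    MeasurableSet {ω | Explores γ t (S ω)} := by
  refine measurableSet_lt measurable_const (Measurable.const_mul ?_ _)
  exact Finset.measurable_sum _ fun k _ => hS k k

theorem measurable_gradBasis_apply (d : ℕ) (k : Fin d) : Measurable fun x => gradBasis d x k :=
  ((continuous_apply k).comp (continuous_gradBasis d)).measurable

theorem measurable_covUpdate {mΩ : MeasurableSpace Ω} (X : Set ℝ)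
    {S : Ω → Matrix (Fin d) (Fin d) ℝ} (hS : ∀ k l, Measurable fun ω => S ω k l)
    {x : Ω → ℝ} (hx : Measurable x) (k l : Fin d) :
    Measurable fun ω => covUpdate X (S ω) (x ω) k l := by
  have hξ : ∀ k, Measurable fun ω => gradBasis d (x ω) k :=
    fun k => (measurable_gradBasis_apply d k).comp hx
  have hδ : Measurable fun ω => informative X (x ω) := (measurable_informative X).comp hx
  simp only [covUpdate, Matrix.sub_apply, Matrix.smul_apply, smul_eq_mul, Matrix.mul_apply, vecMulVec_apply,
    dotProduct, mulVec]
  fun_prop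

theorem measurable_lsUpdate_est {mΩ : MeasurableSpace Ω} (X : Set ℝ) {s : Ω → State d}
    (hS : ∀ k l, Measurable fun ω => (s ω).cov k l) (hs : ∀ k, Measurable fun ω => (s ω).est k)
    {x p : Ω → ℝ} (hx : Measurable x) (hp : Measurable p) (k : Fin d) :
    Measurable fun ω => (lsUpdate X (s ω) (x ω) (p ω)).est k := by
  have hξ : ∀ k, Measurable fun ω => gradBasis d (x ω) k :=
    fun k => (measurable_gradBasis_apply d k).comp hx
  have hδ : Measurable fun ω => informative X (x ω) := (measurable_informative X).comp hx
  have hU := measurable_covUpdate X hS hx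
  simp only [lsUpdate, Pi.sub_apply, Pi.smul_apply, smul_eq_mul, dotProduct, mulVec]
  fun_prop

variable (g : Agent d) (γ : ℝ)

/-- The matrix `Σ(t)` depends only on the responses in the exploration steps. -/
theorem Agent.measurable_cov {mΩ : MeasurableSpace Ω} (ε e : ℕ → Ω → ℝ) (y : ℕ → Ω → ℝ) {t : ℕ}
    (hy : ∀ s < t, Measurable (y s))
    (hxy : ∀ s < t, ∀ ω, Explores γ s (g.state γ (ε · ω) (e · ω) s).cov →
      g.response γ (ε · ω) (e · ω) (s + 1) = y s ω) (k l : Fin d) :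
    Measurable fun ω => (g.state γ (ε · ω) (e · ω) t).cov k l := by
  induction t generalizing k l with
  | zero => exact measurable_const
  | succ t ih =>
    have hS := ih (fun s hs => hy s (by omega)) (fun s hs => hxy s (by omega))
    classical
    have heq : (fun ω => (g.state γ (ε · ω) (e · ω) (t + 1)).cov k l) = fun ω =>
        if Explores γ t (g.state γ (ε · ω) (e · ω) t).cov then
          covUpdate g.X (g.state γ (ε · ω) (e · ω) t).cov (y t ω) k l
        else (g.state γ (ε · ω) (e · ω) t).cov k l := by
      ext ω
      split_ifs with h
      · rw [g.state_succ_of_explores γ _ _ h, ← hxy t (by omega) ω h]; rfl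
      · rw [g.state_succ_of_not_explores γ _ _ h]
    rw [heq]
    exact Measurable.ite (measurableSet_explores γ t hS)
      (measurable_covUpdate g.X hS (hy t (by omega)) k l) (hS k l)

/-- Only matrices strictly before `t` enter, so the counter is predictable, as the martingale bound
demands. -/
theorem Agent.measurable_explorations {mΩ : MeasurableSpace Ω} (ε e : ℕ → Ω → ℝ) {t : ℕ}
    (hS : ∀ s < t, ∀ k l, Measurable fun ω => (g.state γ (ε · ω) (e · ω) s).cov k l) :
    Measurable fun ω => g.explorations γ (ε · ω) (e · ω) t := by
  induction t with
  | zero => exact measurable_const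
  | succ t ih =>
    classical
    exact (ih fun s hs => hS s (by omega)).add
      (Measurable.ite (measurableSet_explores γ t (hS t (by omega))) measurable_const
        measurable_const)

theorem Agent.measurable_response_of_state {mΩ : MeasurableSpace Ω} {ε e : ℕ → Ω → ℝ}
    (hbr : Measurable g.br) (hε : ∀ t, Measurable (ε t)) {t : ℕ}
    (hS : ∀ k l, Measurable fun ω => (g.state γ (ε · ω) (e · ω) t).cov k l)
    (hs : ∀ k, Measurable fun ω => (g.state γ (ε · ω) (e · ω) t).est k) :
    Measurable fun ω => g.response γ (ε · ω) (e · ω) (t + 1) := by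
  classical
  refine hbr.comp (Measurable.ite (measurableSet_explores γ t hS) (hε _) ?_)
  simp only [dotProduct]
  fun_prop

theorem Agent.measurable_state {mΩ : MeasurableSpace Ω} {ε e : ℕ → Ω → ℝ}
    (hbr : Measurable g.br) (hε : ∀ t, Measurable (ε t)) (he : ∀ t, Measurable (e t)) (t : ℕ) :
    (∀ k l, Measurable fun ω => (g.state γ (ε · ω) (e · ω) t).cov k l) ∧
      ∀ k, Measurable fun ω => (g.state γ (ε · ω) (e · ω) t).est k := by
  induction t with
  | zero => exact ⟨fun k l => measurable_const, fun k => measurable_const⟩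
  | succ t ih =>
    obtain ⟨hS, hs⟩ := ih
    have hx := g.measurable_response_of_state γ hbr hε hS hs
    have hobs : Measurable fun ω => observation g.θ (g.response γ (ε · ω) (e · ω) (t + 1))
        (e (t + 1) ω) := by
      have hξ : ∀ k, Measurable fun ω => gradBasis d (g.response γ (ε · ω) (e · ω) (t + 1)) k :=
        fun k => (measurable_gradBasis_apply d k).comp hx
      simp only [observation, dotProduct]
      fun_prop
    classical
    have heq : ∀ ω, g.state γ (ε · ω) (e · ω) (t + 1) =
        if Explores γ t (g.state γ (ε · ω) (e · ω) t).cov then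
          lsUpdate g.X (g.state γ (ε · ω) (e · ω) t) (g.response γ (ε · ω) (e · ω) (t + 1))
            (observation g.θ (g.response γ (ε · ω) (e · ω) (t + 1)) (e (t + 1) ω))
        else g.state γ (ε · ω) (e · ω) t := by
      intro ω
      split_ifs with h
      · exact g.state_succ_of_explores γ _ _ h
      · exact g.state_succ_of_not_explores γ _ _ h
    have hE := measurableSet_explores γ t hS
    constructor
    · intro k l
      simp only [heq, apply_ite (fun s : State d => s.cov k l)]
      exact Measurable.ite hE (measurable_covUpdate g.X hS hx k l) (hS k l)
    · intro k
      simp only [heq, apply_ite (fun s : State d => s.est k)]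
      exact Measurable.ite hE (measurable_lsUpdate_est g.X hS hs hx hobs k) (hs k)

theorem Agent.measurable_response {mΩ : MeasurableSpace Ω} {ε e : ℕ → Ω → ℝ}
    (hbr : Measurable g.br) (hε : ∀ t, Measurable (ε t)) (he : ∀ t, Measurable (e t)) (t : ℕ) :
    Measurable fun ω => g.response γ (ε · ω) (e · ω) (t + 1) :=
  g.measurable_response_of_state γ hbr hε (g.measurable_state γ hbr hε he t).1
    (g.measurable_state γ hbr hε he t).2

/-- The regressors at the points of a compact strategy set are uniformly bounded. -/
theorem exists_abs_gradBasis_le (d : ℕ) (lo hi : ℝ) :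
    ∃ B : ℝ, 0 ≤ B ∧ ∀ x ∈ Set.Icc lo hi, ∀ k, |gradBasis d x k| ≤ B := by
  obtain ⟨B, hB⟩ := isCompact_Icc.exists_bound_of_continuousOn (s := Set.Icc lo hi)
    (continuous_gradBasis d).continuousOn
  exact ⟨max B 0, le_max_right _ _, fun x hx k =>
    ((norm_le_pi_norm (gradBasis d x) k).trans (hB x hx)).trans (le_max_left _ _)⟩

end RAID

/-! ### Linear growth of perturbed positive definite matrices. -/

/-- Compactness of the sup-norm sphere and homogeneity; `d + 1` compares the norms and keeps the
divisor nonzero for `d = 0`, when the sphere is empty. -/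
theorem Matrix.PosDef.exists_pos_mul_dotProduct_le {d : ℕ} {G : Matrix (Fin d) (Fin d) ℝ}
    (hG : G.PosDef) : ∃ c : ℝ, 0 < c ∧ ∀ v : Fin d → ℝ, c * (v ⬝ᵥ v) ≤ v ⬝ᵥ G *ᵥ v := by
  have hcont : Continuous fun v : Fin d → ℝ => v ⬝ᵥ G *ᵥ v := by
    simp only [dotProduct, mulVec]; fun_prop
  obtain ⟨b, hb, hmin⟩ : ∃ b : ℝ, 0 < b ∧ ∀ u ∈ Metric.sphere (0 : Fin d → ℝ) 1,
      b ≤ u ⬝ᵥ G *ᵥ u := by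
    rcases (Metric.sphere (0 : Fin d → ℝ) 1).eq_empty_or_nonempty with h | h
    · exact ⟨1, one_pos, fun u hu => absurd hu (h ▸ Set.notMem_empty u)⟩
    · obtain ⟨u, hu, hmin⟩ := (isCompact_sphere (0 : Fin d → ℝ) 1).exists_isMinOn h hcont.continuousOn
      have hu0 : u ≠ 0 := by rintro rfl; simp at hu
      exact ⟨_, by simpa using hG.dotProduct_mulVec_pos hu0, fun w hw => hmin hw⟩
  refine ⟨b / (d + 1), by positivity, fun v => ?_⟩
  rcases eq_or_ne v 0 with rfl | hv
  · simp
  have hn : 0 < ‖v‖ := norm_pos_iff.2 hv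
  have h1 := hmin (‖v‖⁻¹ • v) (by simp [norm_smul, hn.ne'])
  rw [mulVec_smul, dotProduct_smul, smul_dotProduct, smul_eq_mul, smul_eq_mul, ← mul_assoc,
    ← mul_inv, inv_mul_eq_div, le_div_iff₀ (by positivity)] at h1
  have h2 : v ⬝ᵥ v ≤ (d + 1) * (‖v‖ * ‖v‖) := by
    calc v ⬝ᵥ v ≤ ∑ _k : Fin d, ‖v‖ * ‖v‖ := by
          refine Finset.sum_le_sum fun k _ => ?_
          rw [← abs_mul_abs_self]
          have := norm_le_pi_norm v k
          rw [Real.norm_eq_abs] at this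
          gcongr
      _ = d * (‖v‖ * ‖v‖) := by simp
      _ ≤ _ := by nlinarith [mul_pos hn hn]
  rw [div_mul_eq_mul_div, div_le_iff₀ (by positivity)]
  nlinarith

theorem eventually_mul_log_le_sq {C c : ℝ} (hc : 0 < c) :
    ∃ N : ℕ, ∀ n : ℕ, N ≤ n → C * (((n : ℝ) + 2) * Real.log (n + 2)) ≤ (c * n) ^ 2 := by
  -- Chosen so that `(|C| + 1) κ = c²/4`, the room left by `n + 2 ≤ 2n`.
  set κ := c ^ 2 / (4 * (|C| + 1)) with hκ
  have hκ0 : 0 < κ := by positivity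
  have h1 : Tendsto (fun n : ℕ => (n : ℝ) + 2) atTop atTop :=
    tendsto_atTop_add_const_right _ _ tendsto_natCast_atTop_atTop
  have h2 := (Real.isLittleO_log_id_atTop.comp_tendsto h1).bound hκ0
  obtain ⟨N, hN⟩ := eventually_atTop.1 h2
  refine ⟨max N 2, fun n hn => ?_⟩
  have h3 := hN n (le_of_max_le_left hn)
  have hn2 : (2 : ℝ) ≤ n := by exact_mod_cast le_of_max_le_right hn
  simp only [Function.comp, id, Real.norm_eq_abs] at h3
  rw [abs_of_nonneg (Real.log_nonneg (by linarith)), abs_of_nonneg (by linarith)] at h3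
  have hlog : 0 ≤ Real.log ((n : ℝ) + 2) := Real.log_nonneg (by linarith)
  calc C * (((n : ℝ) + 2) * Real.log (n + 2))
      ≤ (|C| + 1) * (((n : ℝ) + 2) * (κ * ((n : ℝ) + 2))) := by
        gcongr
        linarith [le_abs_self C]
    _ = c ^ 2 / 4 * ((n : ℝ) + 2) ^ 2 := by rw [hκ]; field_simp
    _ ≤ c ^ 2 / 4 * (2 * n) ^ 2 := by gcongr; linarith
    _ = (c * n) ^ 2 := by ring

theorem Matrix.dotProduct_mulVec_le_of_sq_le {d : ℕ} {E : Matrix (Fin d) (Fin d) ℝ} {r : ℝ}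
    (hE : ∀ k l, E k l ^ 2 ≤ r ^ 2) (hr : 0 ≤ r) (v : Fin d → ℝ) :
    -(d * r * (v ⬝ᵥ v)) ≤ v ⬝ᵥ E *ᵥ v := by
  have habs : ∀ k l, |E k l| ≤ r := fun k l => abs_le_of_sq_le_sq (hE k l) hr
  have hsum : ∑ k, ∑ l, -(r * ((v k * v k + v l * v l) / 2)) ≤ ∑ k, ∑ l, v k * (E k l * v l) := by
    refine Finset.sum_le_sum fun k _ => Finset.sum_le_sum fun l _ => ?_
    have h1 : |v k * (E k l * v l)| ≤ r * (|v k| * |v l|) := by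
      rw [abs_mul, abs_mul]
      nlinarith [mul_le_mul_of_nonneg_right (habs k l)
        (mul_nonneg (abs_nonneg (v k)) (abs_nonneg (v l)))]
    have h2 : |v k| * |v l| ≤ (v k * v k + v l * v l) / 2 := by
      nlinarith [sq_nonneg (|v k| - |v l|), abs_mul_abs_self (v k), abs_mul_abs_self (v l)]
    have h3 := mul_le_mul_of_nonneg_left h2 hr
    linarith [neg_abs_le (v k * (E k l * v l))]
  have hl : ∑ k, ∑ l, -(r * ((v k * v k + v l * v l) / 2)) = -(d * r * (v ⬝ᵥ v)) := by
    have : ∑ k, ∑ l, (v k * v k + v l * v l) = 2 * d * (v ⬝ᵥ v) := by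
      simp only [Finset.sum_add_distrib, Finset.sum_const, Finset.card_univ, Fintype.card_fin,
        nsmul_eq_mul, ← Finset.mul_sum, dotProduct]
      ring
    have h2 : ∑ k, ∑ l, -(r * ((v k * v k + v l * v l) / 2))
        = -(r / 2) * ∑ k, ∑ l, (v k * v k + v l * v l) := by
      simp only [Finset.mul_sum]
      refine Finset.sum_congr rfl fun k _ => Finset.sum_congr rfl fun l _ => by ring
    rw [h2, this]; ring
  rw [← hl]
  refine hsum.trans (le_of_eq ?_)
  simp only [dotProduct, mulVec, Finset.mul_sum]

/-- A positive semidefinite matrix that is entrywise `T G + O(√(T log T))` with `G` positive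
definite grows linearly in `T`. -/
theorem exists_linear_lower_bound {d : ℕ} {J G : Matrix (Fin d) (Fin d) ℝ} (hJ : J.PosDef)
    (hG : G.PosDef) (C : ℝ) : ∃ c : ℝ, 0 < c ∧ ∀ (T : ℕ) (E : Matrix (Fin d) (Fin d) ℝ),
      E.PosSemidef → (∀ k l, (E k l - T * G k l) ^ 2 ≤ C * (((T : ℝ) + 2) * Real.log (T + 2))) →
      ∀ v : Fin d → ℝ, c * ((T : ℝ) + 1) * (v ⬝ᵥ v) ≤ v ⬝ᵥ (J + E) *ᵥ v := by
  obtain ⟨a, ha, hJa⟩ := hJ.exists_pos_mul_dotProduct_le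
  obtain ⟨b, hb, hGb⟩ := hG.exists_pos_mul_dotProduct_le
  -- An entrywise deviation of `b T / (2(d+1))` lowers the quadratic form by at most half of what `T
  -- G` provides.
  obtain ⟨N, hN⟩ := eventually_mul_log_le_sq (C := C) (c := b / (2 * (d + 1))) (by positivity)
  -- `b/4` serves large `T`, where `T + 1 ≤ 2T`; for `T ≤ N` the fixed matrix `J` suffices and gives
  -- `a/(N+2)`.
  refine ⟨min (b / 4) (a / (N + 2)), by positivity, fun T E hE hT v => ?_⟩
  have hvv : 0 ≤ v ⬝ᵥ v := Finset.sum_nonneg fun i _ => mul_self_nonneg _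
  have hEv : 0 ≤ v ⬝ᵥ E *ᵥ v := by simpa using hE.dotProduct_mulVec_nonneg v
  rw [add_mulVec, dotProduct_add]
  rcases le_or_gt (N + 1) T with h | h
  · have hT1 : (1 : ℝ) ≤ T := by exact_mod_cast (by omega : 1 ≤ T)
    have h1 := dotProduct_mulVec_le_of_sq_le (E := E - (T : ℝ) • G) (r := b / (2 * (d + 1)) * T)
      (fun k l => by simpa using (hT k l).trans (hN T (by omega))) (by positivity) v
    rw [sub_mulVec, dotProduct_sub, smul_mulVec, dotProduct_smul, smul_eq_mul] at h1
    have h2 : d * (b / (2 * (d + 1)) * T) ≤ b / 2 * T := by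
      have h3 : d * (b / (2 * ((d : ℝ) + 1))) ≤ b / 2 := by
        rw [← mul_div_assoc, div_le_div_iff₀ (by positivity) (by norm_num)]
        nlinarith
      nlinarith
    have h4 := mul_le_mul_of_nonneg_right h2 hvv
    have h5 := mul_le_mul_of_nonneg_left (hGb v) (by positivity : (0 : ℝ) ≤ T)
    have h6 : min (b / 4) (a / (N + 2)) * ((T : ℝ) + 1) ≤ b / 2 * T := by
      have h8 : min (b / 4) (a / ((N : ℝ) + 2)) ≤ b / 4 := min_le_left _ _
      nlinarith
    have h7 := mul_le_mul_of_nonneg_right h6 hvv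
    have h9 : 0 ≤ v ⬝ᵥ J *ᵥ v := by simpa using hJ.posSemidef.dotProduct_mulVec_nonneg v
    linarith
  · have hTN : (T : ℝ) + 1 ≤ N + 2 := by exact_mod_cast (by omega : T + 1 ≤ N + 2)
    have h6 : min (b / 4) (a / (N + 2)) * ((T : ℝ) + 1) ≤ a := by
      calc min (b / 4) (a / (N + 2)) * ((T : ℝ) + 1) ≤ a / (N + 2) * (N + 2) :=
            mul_le_mul (min_le_right _ _) hTN (by positivity) (by positivity)
        _ = a := by field_simp
    have h7 := mul_le_mul_of_nonneg_right h6 hvv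
    linarith [hJa v]

/-! ### Excitation by Gaussian probing. -/

namespace RAID

variable {d : ℕ} (g : Agent d) (γ : ℝ)

/-- The contribution of the probing value `p` to the information matrix. -/
noncomputable def Agent.probeInformation (p : ℝ) : Matrix (Fin d) (Fin d) ℝ :=
  informative g.X (g.br p) • vecMulVec (gradBasis d (g.br p)) (gradBasis d (g.br p))

/-- The expected information of one exploration step. -/
noncomputable def Agent.meanInformation (μ : Measure ℝ) : Matrix (Fin d) (Fin d) ℝ :=
  Matrix.of fun k l => ∫ p, g.probeInformation p k l ∂μ

theorem Agent.measurable_probeInformation (hbr : Measurable g.br) (k l : Fin d) :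
    Measurable fun p => g.probeInformation p k l := by
  have h1 : Measurable fun p => informative g.X (g.br p) := (measurable_informative g.X).comp hbr
  have h2 : ∀ k, Measurable fun p => gradBasis d (g.br p) k :=
    fun k => (measurable_gradBasis_apply d k).comp hbr
  simp only [Agent.probeInformation, Matrix.smul_apply, smul_eq_mul, vecMulVec_apply]
  fun_prop

theorem Agent.exists_abs_probeInformation_le {lo hi : ℝ} (hX : g.X = Set.Icc lo hi)
    (hbr : IsBestResponse g.X g.θ g.br) :
    ∃ B : ℝ, 0 ≤ B ∧ ∀ p k l, |g.probeInformation p k l| ≤ B := by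
  obtain ⟨B, hB0, hB⟩ := exists_abs_gradBasis_le d lo hi
  refine ⟨B * B, by positivity, fun p k l => ?_⟩
  have hmem : g.br p ∈ Set.Icc lo hi := hX ▸ (hbr p).1
  have h1 := informative_nonneg g.X (g.br p)
  have h2 := informative_le_one g.X (g.br p)
  simp only [Agent.probeInformation, Matrix.smul_apply, smul_eq_mul, vecMulVec_apply, abs_mul]
  rw [abs_of_nonneg h1]
  calc informative g.X (g.br p) * (|gradBasis d (g.br p) k| * |gradBasis d (g.br p) l|)
      ≤ 1 * (B * B) := by
        gcongr
        · exact hB _ hmem k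
        · exact hB _ hmem l
    _ = B * B := one_mul _

theorem Agent.dotProduct_probeInformation (p : ℝ) (v : Fin d → ℝ) :
    v ⬝ᵥ g.probeInformation p *ᵥ v
      = informative g.X (g.br p) * (v ⬝ᵥ gradBasis d (g.br p)) ^ 2 := by
  rw [Agent.probeInformation, smul_mulVec, vecMulVec_mulVec, dotProduct_smul, dotProduct_smul,
    dotProduct_comm (gradBasis d (g.br p)) v]
  simp [sq]

theorem finite_setOf_dotProduct_gradBasis_eq_zero {v : Fin d → ℝ} (hv : v ≠ 0) :
    {x : ℝ | v ⬝ᵥ gradBasis d x = 0}.Finite := by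
  classical
  set q : Polynomial ℝ := ∑ k : Fin d, Polynomial.monomial k.val (v k * (k.val + 1)) with hq
  have hq0 : q ≠ 0 := by
    obtain ⟨k, hk⟩ := Function.ne_iff.1 hv
    intro h
    have hc : q.coeff k.val = v k * (k.val + 1) := by
      rw [hq, Polynomial.finsetSum_coeff, Finset.sum_eq_single k]
      · simp
      · intro j _ hj
        rw [Polynomial.coeff_monomial, if_neg (fun h => hj (Fin.ext h))]
      · simp
    rw [h, Polynomial.coeff_zero] at hc
    have : (k.val : ℝ) + 1 ≠ 0 := by positivity
    exact (mul_ne_zero hk this) hc.symm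
  refine (q.roots.toFinset.finite_toSet).subset fun x hx => ?_
  simp only [Finset.mem_coe, Multiset.mem_toFinset]
  rw [Polynomial.mem_roots hq0, Polynomial.IsRoot.def, hq, Polynomial.eval_finsetSum]
  simp only [Set.mem_ofPred_eq, dotProduct, gradBasis_apply] at hx
  rw [← hx]
  refine Finset.sum_congr rfl fun k _ => ?_
  rw [Polynomial.eval_monomial]; ring

/-- Gaussian probing excites every direction of the parameter space. -/
theorem Agent.posDef_meanInformation {lo hi m M : ℝ} (hX : g.X = Set.Icc lo hi)
    (hθ : g.θ ∈ admissibleTypes g.X m M) (hm : 0 < m) (hbr : IsBestResponse g.X g.θ g.br)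
    (hdes : g.xdes ∈ interior g.X) {v : ℝ≥0} (hv : v ≠ 0) :
    (g.meanInformation (gaussianReal 0 v)).PosDef := by
  set μ := gaussianReal 0 v with hμ
  have hcont : Continuous g.br := (hX ▸ hbr : IsBestResponse (Set.Icc lo hi) _ _).continuous
    (hX ▸ hθ) hm
  have hmeas := g.measurable_probeInformation hcont.measurable
  obtain ⟨B, hB0, hB⟩ := g.exists_abs_probeInformation_le hX hbr
  have hint : ∀ k l, Integrable (fun p => g.probeInformation p k l) μ := fun k l =>
    (integrable_const B).mono' (hmeas k l).aestronglyMeasurable (ae_of_all _ fun p => hB p k l)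
  refine PosDef.of_dotProduct_mulVec_pos ?_ fun w hw => ?_
  · ext k l
    simp only [conjTranspose_apply, Agent.meanInformation, of_apply, star_trivial,
      Agent.probeInformation, Matrix.smul_apply, vecMulVec_apply, smul_eq_mul]
    congr 1 with p
    ring
  · have hform : star w ⬝ᵥ g.meanInformation μ *ᵥ w
        = ∫ p, w ⬝ᵥ g.probeInformation p *ᵥ w ∂μ := by
      simp only [dotProduct, mulVec, Agent.meanInformation, of_apply, star_trivial]
      rw [integral_finsetSum _ fun k _ => Integrable.const_mul
        (integrable_finsetSum _ fun l _ => (hint k l).mul_const _) _]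
      refine Finset.sum_congr rfl fun k _ => ?_
      rw [integral_const_mul, integral_finsetSum _ fun l _ => (hint k l).mul_const _]
      simp only [integral_mul_const]
    have hfi : Integrable (fun p => w ⬝ᵥ g.probeInformation p *ᵥ w) μ := by
      simp only [dotProduct, mulVec]
      exact integrable_finsetSum _ fun k _ => Integrable.const_mul
        (integrable_finsetSum _ fun l _ => (hint k l).mul_const _) _
    have hnn : ∀ p, 0 ≤ w ⬝ᵥ g.probeInformation p *ᵥ w := fun p => by
      rw [g.dotProduct_probeInformation]
      exact mul_nonneg (informative_nonneg _ _) (sq_nonneg _)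
    rw [hform]
    refine lt_of_le_of_ne (integral_nonneg hnn) fun h0 => ?_
    have hae := (integral_eq_zero_iff_of_nonneg hnn hfi).1 h0.symm
    set Z := {x : ℝ | w ⬝ᵥ gradBasis d x = 0} with hZ
    have hZfin : Z.Finite := finite_setOf_dotProduct_gradBasis_eq_zero hw
    -- At an interior response the price is determined by the response, so prices leading to a root
    -- of the polynomial form a finite set, null for a Gaussian.
    have hnull : μ ((fun x => -(g.θ ⬝ᵥ gradBasis d x)) '' Z) = 0 :=
      haveI := nullSingletonClass_gaussianReal (μ := 0) hv
      (hZfin.image _).measure_zero μ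
    have hU : μ (g.br ⁻¹' interior g.X) = 0 := by
      have hsub : g.br ⁻¹' interior g.X ⊆ {p | ¬ (w ⬝ᵥ g.probeInformation p *ᵥ w = 0)} ∪
          (fun x => -(g.θ ⬝ᵥ gradBasis d x)) '' Z := by
        intro p hp
        by_cases h : w ⬝ᵥ gradBasis d (g.br p) = 0
        · right
          refine ⟨g.br p, h, ?_⟩
          have := (hX ▸ hbr : IsBestResponse (Set.Icc lo hi) _ _).marginal_eq (hX ▸ hp)
          simp [this]
        · left
          have h1 : informative g.X (g.br p) = 1 := by
            have hp' : g.br p ∈ interior g.X := hp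
            simp [informative, hp']
          simp only [Set.mem_ofPred_eq, g.dotProduct_probeInformation, h1, one_mul]
          exact pow_ne_zero 2 h
      exact measure_mono_null hsub (measure_union_null hae hnull)
    -- An open set of Lebesgue measure zero is empty, yet this one contains the price that induces
    -- the interior target.
    have hvol : volume (g.br ⁻¹' interior g.X) = 0 := gaussianReal_absolutelyContinuous' 0 hv hU
    have hopen : IsOpen (g.br ⁻¹' interior g.X) := isOpen_interior.preimage hcont
    have hempty := hopen.measure_eq_zero_iff volume |>.1 hvol
    have hin : -(g.θ ⬝ᵥ gradBasis d g.xdes) ∈ g.br ⁻¹' interior g.X := by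
      have := (hX ▸ hbr : IsBestResponse (Set.Icc lo hi) _ _).eq_of_neg_marginal (hX ▸ hθ) hm
        (hX ▸ interior_subset hdes)
      rw [Set.mem_preimage, this]; exact hdes
    rw [hempty] at hin
    exact hin

end RAID

/-! ### Filtrations and almost sure bounds for information and noise. -/

namespace RAID

/-- The filtration `σ(f 0, …, f (s - 1))` of the strict past of a process. -/
def pastFiltration {Ω : Type*} [mΩ : MeasurableSpace Ω] (f : ℕ → Ω → ℝ)
    (hf : ∀ s, Measurable (f s)) : Filtration ℕ mΩ where
  seq s := ⨆ r ∈ Set.Iio s, MeasurableSpace.comap (f r) inferInstance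
  mono' _ _ hst := biSup_mono fun _ hr => lt_of_lt_of_le hr hst
  le' _ := iSup₂_le fun r _ => (hf r).comap_le

theorem measurable_pastFiltration {Ω : Type*} [MeasurableSpace Ω] {f : ℕ → Ω → ℝ}
    (hf : ∀ s, Measurable (f s)) {r s : ℕ} (hrs : r < s) :
    Measurable[pastFiltration f hf s] (f r) :=
  (comap_measurable (f r)).mono
    (le_iSup₂_of_le (f := fun r (_ : r ∈ Set.Iio s) => MeasurableSpace.comap (f r) inferInstance)
      r hrs le_rfl) le_rfl

theorem indep_pastFiltration {Ω : Type*} [MeasurableSpace Ω] {P : Measure Ω} {f : ℕ → Ω → ℝ}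
    (hf : ∀ s, Measurable (f s)) (hind : iIndepFun f P) (s : ℕ) :
    Indep (MeasurableSpace.comap (f s) inferInstance) (pastFiltration f hf s) P := by
  suffices Indep (⨆ k ∈ ({s} : Set ℕ), MeasurableSpace.comap (f k) inferInstance)
      (⨆ k ∈ Set.Iio s, MeasurableSpace.comap (f k) inferInstance) P by
    rwa [iSup_singleton] at this
  exact indep_iSup_of_disjoint (fun k => (hf k).comap_le) hind (by simp)

open Classical in
theorem measurable_ite_explores {d : ℕ} {Ω : Type*} {mΩ : MeasurableSpace Ω} (γ : ℝ) (t : ℕ)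
    {S : Ω → Matrix (Fin d) (Fin d) ℝ} (hS : ∀ k l, Measurable fun ω => S ω k l) {f h : Ω → ℝ}
    (hf : Measurable f) (hh : Measurable h) :
    Measurable fun ω => if Explores γ t (S ω) then f ω else h ω :=
  Measurable.ite (measurableSet_explores γ t hS) hf hh

/-- The responses up to time `s + 1` and the noise up to time `s`. -/
noncomputable def Agent.history {d : ℕ} (g : Agent d) (γ : ℝ) {Ω : Type*} (ε e : ℕ → Ω → ℝ)
    (s : ℕ) (ω : Ω) :
    (Set.Icc 1 (s + 1) → ℝ) × (Set.Ico 1 (s + 1) → ℝ) :=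
  ((fun r : Set.Icc 1 (s + 1) => g.response γ (ε · ω) (e · ω) r),
    (fun r : Set.Ico 1 (s + 1) => e r ω))

theorem Agent.comap_history_mono {d : ℕ} (g : Agent d) (γ : ℝ) {Ω : Type*}
    (ε e : ℕ → Ω → ℝ) :
    Monotone fun s => MeasurableSpace.comap (g.history γ ε e s) inferInstance := by
  intro s t hst
  let π : (Set.Icc 1 (t + 1) → ℝ) × (Set.Ico 1 (t + 1) → ℝ) →
      (Set.Icc 1 (s + 1) → ℝ) × (Set.Ico 1 (s + 1) → ℝ) := fun z =>
    (fun r => z.1 ⟨r.1, r.2.1, r.2.2.trans (by omega)⟩,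
      fun r => z.2 ⟨r.1, r.2.1, lt_of_lt_of_le r.2.2 (by omega)⟩)
  have hπ : Measurable π := by fun_prop
  exact (hπ.comp (comap_measurable (g.history γ ε e t))).comap_le

variable {d : ℕ} (g : Agent d) (γ : ℝ) {Ω : Type*} [mΩ : MeasurableSpace Ω] {P : Measure Ω}
  [IsProbabilityMeasure P] {ε e : ℕ → Ω → ℝ}

open Classical in
-- Separates the predictable decision to explore from the fresh probe, displaying the information as
-- a transform of i.i.d. matrices.
theorem Agent.weight_smul_eq (ε e : ℕ → ℝ) (s : ℕ) :
    g.weight γ ε e s • vecMulVec (g.regressor γ ε e s) (g.regressor γ ε e s)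
      = (if Explores γ s (g.state γ ε e s).cov then (1 : ℝ) else 0)
        • g.probeInformation (ε (s + 1)) := by
  by_cases h : Explores γ s (g.state γ ε e s).cov
  · simp [Agent.weight, Agent.regressor, Agent.probeInformation, h,
      g.response_eq_of_explores γ ε e h]
  · simp [Agent.weight, h]

open Classical in
theorem Agent.explorations_eq_sum (ε e : ℕ → ℝ) (t : ℕ) : (g.explorations γ ε e t : ℝ)
    = ∑ s ∈ Finset.range t, if Explores γ s (g.state γ ε e s).cov then (1 : ℝ) else 0 := by
  induction t with
  | zero => simp [Agent.explorations]
  | succ t ih => rw [Finset.sum_range_succ, ← ih, Agent.explorations]; push_cast; rfl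

/-- Persistent excitation: almost surely the information matrix grows linearly in the number of
exploration steps. -/
theorem Agent.ae_information_lower_bound {lo hi m M : ℝ} (hX : g.X = Set.Icc lo hi)
    (hθ : g.θ ∈ admissibleTypes g.X m M) (hm : 0 < m) (hbr : IsBestResponse g.X g.θ g.br)
    (hdes : g.xdes ∈ interior g.X) (h0 : g.cov₀.PosDef) {v : ℝ≥0} (hv : v ≠ 0)
    (hε_meas : ∀ t, Measurable (ε t)) (hε_law : ∀ t ≥ 1, P.map (ε t) = gaussianReal 0 v)
    (hε_indep : iIndepFun (fun t : ℕ => ε (t + 1)) P) :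
    ∀ᵐ ω ∂P, ∃ c : ℝ, 0 < c ∧ ∀ (t : ℕ) (w : Fin d → ℝ),
      c * ((g.explorations γ (ε · ω) (e · ω) t : ℝ) + 1) * (w ⬝ᵥ w)
        ≤ w ⬝ᵥ g.information γ (ε · ω) (e · ω) t *ᵥ w := by
  classical
  have hcont : Continuous g.br := (hX ▸ hbr : IsBestResponse (Set.Icc lo hi) _ _).continuous
    (hX ▸ hθ) hm
  have hmeas := g.measurable_probeInformation hcont.measurable
  obtain ⟨B, hB0, hB⟩ := g.exists_abs_probeInformation_le hX hbr
  set G := g.meanInformation (gaussianReal 0 v) with hG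
  have hGpos : G.PosDef := g.posDef_meanInformation hX hθ hm hbr hdes hv
  set 𝓖 := pastFiltration (fun t => ε (t + 1)) (fun t => hε_meas (t + 1)) with h𝓖
  have hεG : ∀ r s, r < s → Measurable[𝓖 s] (ε (r + 1)) := fun r s hrs =>
    measurable_pastFiltration (fun t => hε_meas (t + 1)) hrs
  have hcov : ∀ s k l, Measurable[𝓖 s] fun ω => (g.state γ (ε · ω) (e · ω) s).cov k l := by
    -- The matrix changes only in exploration rounds, where the response is a function of the probe;
    -- hence it is measurable in past probes alone, although exploitation responses involve the
    -- noise.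
    intro s
    exact @Agent.measurable_cov d Ω g γ (𝓖 s) ε e (fun r ω => g.br (ε (r + 1) ω)) s
      (fun r hr => hcont.measurable.comp (hεG r s hr))
      (fun r _ ω h => g.response_eq_of_explores γ _ _ h)
  have hGB : ∀ k l, |G k l| ≤ B := by
    intro k l
    have h1 : ‖∫ p, g.probeInformation p k l ∂gaussianReal 0 v‖ ≤ B * (gaussianReal 0 v).real .univ :=
      norm_integral_le_of_norm_le_const (ae_of_all _ fun p => hB p k l)
    simpa [hG, Agent.meanInformation] using h1
  set f : Fin d → Fin d → ℕ → Ω → ℝ := fun k l s ω => g.probeInformation (ε (s + 1) ω) k l - G k l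
    with hf
  have hfB : ∀ k l s ω, |f k l s ω| ≤ 2 * B := fun k l s ω => by
    refine (abs_sub _ _).trans ?_
    linarith [hB (ε (s + 1) ω) k l, hGB k l]
  have hfm : ∀ k l, Measurable fun p => g.probeInformation p k l - G k l :=
    fun k l => (hmeas k l).sub_const _
  have hfm' : ∀ k l s, Measurable (f k l s) := fun k l s => (hfm k l).comp (hε_meas (s + 1))
  have hfp : ∀ k l s ω, |f k l s ω| ^ (3 : ℝ) ≤ (2 * B) ^ (3 : ℝ) := fun k l s ω =>
    Real.rpow_le_rpow (abs_nonneg _) (hfB k l s ω) (by norm_num)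
  have hfi : ∀ k l s, Integrable (fun ω => |f k l s ω| ^ (3 : ℝ)) P := fun k l s =>
    (integrable_const ((2 * B) ^ (3 : ℝ))).mono'
      ((continuous_abs.measurable.comp (hfm' k l s)).pow_const _).aestronglyMeasurable
      (ae_of_all _ fun ω => by
        rw [Real.norm_of_nonneg (by positivity)]; exact hfp k l s ω)
  have key : ∀ k l, ∀ᵐ ω ∂P, ∃ C : ℝ, ∀ t, (∑ s ∈ Finset.range t,
      (if Explores γ s (g.state γ (ε · ω) (e · ω) s).cov then (1 : ℝ) else 0) * f k l s ω) ^ 2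
        ≤ C * (((g.explorations γ (ε · ω) (e · ω) t : ℝ) + 2)
          * Real.log (g.explorations γ (ε · ω) (e · ω) t + 2)) := by
    intro k l
    -- The centered probe information is bounded, so any exponent in `(2, 3]` would do.
    refine ae_sq_sum_mul_le_mul_log 𝓖 (p := 3) (B := 1) (K := (2 * B) ^ (3 : ℝ)) (by norm_num)
      le_rfl (T := fun t ω => g.explorations γ (ε · ω) (e · ω) t)
      (w := fun s ω => if Explores γ s (g.state γ (ε · ω) (e · ω) s).cov then (1 : ℝ) else 0)
      (fun s => (hfm k l).comp (hεG s (s + 1) s.lt_succ_self)) (fun s => ?_) (fun s => ?_)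
      (hfi k l) (fun s => ?_) (fun s => ?_) (fun s ω => ?_) (fun ω => rfl) (fun s => ?_)
      (fun s ω => ?_)
    · refine indep_of_indep_of_le_left
        (indep_pastFiltration (fun t => hε_meas (t + 1)) hε_indep s) ?_
      exact ((hfm k l).comp (comap_measurable (ε (s + 1)))).comap_le
    · have h1 : ∫ ω, f k l s ω ∂P
          = ∫ p, (g.probeInformation p k l - G k l) ∂(P.map (ε (s + 1))) :=
        (integral_map (hε_meas (s + 1)).aemeasurable (hfm k l).aestronglyMeasurable).symm
      rw [h1, hε_law (s + 1) (by omega), integral_sub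
        ((integrable_const B).mono' (hmeas k l).aestronglyMeasurable (ae_of_all _ fun p => hB p k l))
        (integrable_const _)]
      simp [hG, Agent.meanInformation]
    · refine (integral_mono (hfi k l s) (integrable_const _) (hfp k l s)).trans ?_
      simp
    · exact @measurable_ite_explores d Ω (𝓖 s) γ s _ (hcov s) _ _ measurable_const measurable_const
    · split_ifs <;> simp
    · exact @Agent.measurable_explorations d Ω g γ (𝓖 s) ε e (s + 1) fun r hr k l =>
        (hcov r k l).mono (𝓖.mono (Nat.lt_succ_iff.1 hr)) le_rfl
    · by_cases h : Explores γ s (g.state γ (ε · ω) (e · ω) s).cov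
      · exact Or.inr (g.explorations_succ_of_explores γ _ _ h)
      · exact Or.inl ⟨g.explorations_succ_of_not_explores γ _ _ h, if_neg h⟩
  have key' := ae_all_iff.2 fun k => ae_all_iff.2 fun l => key k l
  filter_upwards [key'] with ω hω
  choose C hC using hω
  obtain ⟨c, hc, hbound⟩ := exists_linear_lower_bound h0.inv hGpos (∑ k, ∑ l, |C k l|)
  refine ⟨c, hc, fun t w => ?_⟩
  refine hbound (g.explorations γ (ε · ω) (e · ω) t) (∑ s ∈ Finset.range t,
    g.weight γ (ε · ω) (e · ω) s • vecMulVec (g.regressor γ (ε · ω) (e · ω) s)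
      (g.regressor γ (ε · ω) (e · ω) s)) ?_ (fun k l => ?_) w
  · exact posSemidef_sum _ fun s _ =>
      (posSemidef_vecMulVec_self _).smul (g.weight_nonneg γ _ _ s)
  · have hL : 0 ≤ ((g.explorations γ (ε · ω) (e · ω) t : ℝ) + 2)
        * Real.log (g.explorations γ (ε · ω) (e · ω) t + 2) := by
      have := log_add_two_pos (g.explorations γ (ε · ω) (e · ω) t); positivity
    have hCle : C k l ≤ ∑ k, ∑ l, |C k l| :=
      (le_abs_self _).trans ((Finset.single_le_sum (f := fun l => |C k l|)
        (fun _ _ => abs_nonneg _) (Finset.mem_univ l)).trans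
        (Finset.single_le_sum (f := fun k => ∑ l, |C k l|)
          (fun _ _ => Finset.sum_nonneg fun _ _ => abs_nonneg _) (Finset.mem_univ k)))
    refine le_trans (le_of_eq ?_) ((hC k l t).trans (mul_le_mul_of_nonneg_right hCle hL))
    congr 1
    simp only [g.weight_smul_eq]
    rw [g.explorations_eq_sum, Matrix.sum_apply, Finset.sum_mul, ← Finset.sum_sub_distrib]
    refine Finset.sum_congr rfl fun s _ => ?_
    simp only [hf, Matrix.smul_apply, smul_eq_mul]
    ring

/-- The filtration generated by the histories. -/
noncomputable def Agent.noiseFiltration (hbr : Measurable g.br) (hε : ∀ t, Measurable (ε t))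
    (he : ∀ t, Measurable (e t)) : Filtration ℕ mΩ where
  seq s := MeasurableSpace.comap (g.history γ ε e s) inferInstance
  mono' := g.comap_history_mono γ ε e
  le' s := by
    refine Measurable.comap_le (Measurable.prodMk (measurable_pi_lambda _ fun r => ?_)
      (measurable_pi_lambda _ fun r => he _))
    obtain ⟨r, hr1, hr2⟩ := r
    obtain ⟨q, rfl⟩ : ∃ q, r = q + 1 := ⟨r - 1, by omega⟩
    exact g.measurable_response γ hbr hε he q

theorem Agent.measurable_noiseFiltration_response (hbr : Measurable g.br)
    (hε : ∀ t, Measurable (ε t)) (he : ∀ t, Measurable (e t)) {r s : ℕ} (hrs : r ≤ s) :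
    Measurable[g.noiseFiltration γ hbr hε he s]
      fun ω => g.response γ (ε · ω) (e · ω) (r + 1) := by
  have hproj : Measurable fun z : (Set.Icc 1 (s + 1) → ℝ) × (Set.Ico 1 (s + 1) → ℝ) =>
      z.1 ⟨r + 1, by omega, by omega⟩ := by fun_prop
  exact hproj.comp (comap_measurable (g.history γ ε e s))

theorem Agent.measurable_noiseFiltration_noise (hbr : Measurable g.br)
    (hε : ∀ t, Measurable (ε t)) (he : ∀ t, Measurable (e t)) {r s : ℕ} (hrs : r < s) :
    Measurable[g.noiseFiltration γ hbr hε he s] (e (r + 1)) := by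
  have hproj : Measurable fun z : (Set.Icc 1 (s + 1) → ℝ) × (Set.Ico 1 (s + 1) → ℝ) =>
      z.2 ⟨r + 1, by omega, by omega⟩ := by fun_prop
  exact hproj.comp (comap_measurable (g.history γ ε e s))

/-- The accumulated noise is almost surely `O(√(T log T))` in the number `T` of explorations. -/
theorem Agent.ae_noiseSum_sq_le {lo hi : ℝ} (hX : g.X = Set.Icc lo hi)
    (hbr : IsBestResponse g.X g.θ g.br) (hbr_meas : Measurable g.br)
    (hε_meas : ∀ t, Measurable (ε t)) (he_meas : ∀ t, Measurable (e t))
    (he_ident : ∀ t ≥ 1, IdentDistrib (e t) (e 1) P P) (he_mean : ∀ t ≥ 1, ∫ ω, e t ω ∂P = 0)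
    {a : ℝ} (ha : 2 < a) (he_moment : ∫⁻ ω, ENNReal.ofReal (|e 1 ω| ^ a) ∂P < ∞)
    (he_resp : ∀ t ≥ 1, IndepFun (e t)
      (fun ω => ((fun s : Set.Icc 1 t => g.response γ (ε · ω) (e · ω) s),
        (fun s : Set.Ico 1 t => e s ω))) P) :
    ∀ᵐ ω ∂P, ∃ C : ℝ, 0 ≤ C ∧ ∀ (t : ℕ) (k : Fin d), g.noiseSum γ (ε · ω) (e · ω) t k ^ 2
      ≤ C * (((g.explorations γ (ε · ω) (e · ω) t : ℝ) + 2)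
        * Real.log (g.explorations γ (ε · ω) (e · ω) t + 2)) := by
  classical
  obtain ⟨B, hB0, hB⟩ := exists_abs_gradBasis_le d lo hi
  -- The second-order expansion requires `p ≤ 3`; lower moments follow from the moment of order `a`.
  set p := min a 3 with hp
  have hp2 : 2 < p := lt_min ha (by norm_num)
  have habs : ∀ t, Measurable fun ω => |e t ω| := fun t =>
    continuous_abs.measurable.comp (he_meas t)
  have hint_a : Integrable (fun ω => |e 1 ω| ^ a) P := by
    refine ⟨((habs 1).pow_const a).aestronglyMeasurable, ?_⟩
    rw [hasFiniteIntegral_iff_ofReal (ae_of_all _ fun ω => by positivity)]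
    exact he_moment
  have hint1 : Integrable (fun ω => |e 1 ω| ^ p) P := by
    refine ((integrable_const (1 : ℝ)).add hint_a).mono'
      ((habs 1).pow_const p).aestronglyMeasurable (ae_of_all _ fun ω => ?_)
    rw [Real.norm_of_nonneg (by positivity)]
    exact rpow_le_one_add_rpow (abs_nonneg _) (by linarith) (min_le_left _ _)
  have hid : ∀ t ≥ 1, IdentDistrib (fun ω => |e t ω| ^ p) (fun ω => |e 1 ω| ^ p) P P :=
    fun t ht => (he_ident t ht).comp (continuous_abs.measurable.pow_const p)
  -- At time `s` this contains the responses up to `s + 1` but the noise only up to `s`: the weight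
  -- and regressor of round `s + 1` are known, and `he_resp` is exactly independence of `e (s + 1)`.
  set 𝓕 := g.noiseFiltration γ hbr_meas hε_meas he_meas with h𝓕
  have hresp : ∀ r s, r ≤ s → Measurable[𝓕 s] fun ω => g.response γ (ε · ω) (e · ω) (r + 1) :=
    fun r s hrs => g.measurable_noiseFiltration_response γ hbr_meas hε_meas he_meas hrs
  have hcov : ∀ s k l, Measurable[𝓕 s] fun ω => (g.state γ (ε · ω) (e · ω) s).cov k l := by
    intro s
    exact @Agent.measurable_cov d Ω g γ (𝓕 s) ε e
      (fun r ω => g.response γ (ε · ω) (e · ω) (r + 1)) s (fun r hr => hresp r s hr.le)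
      (fun r _ ω _ => rfl)
  have key : ∀ k, ∀ᵐ ω ∂P, ∃ C : ℝ, ∀ t, (∑ s ∈ Finset.range t,
      (g.weight γ (ε · ω) (e · ω) s * g.regressor γ (ε · ω) (e · ω) s k) * e (s + 1) ω) ^ 2
        ≤ C * (((g.explorations γ (ε · ω) (e · ω) t : ℝ) + 2)
          * Real.log (g.explorations γ (ε · ω) (e · ω) t + 2)) := by
    intro k
    refine ae_sq_sum_mul_le_mul_log 𝓕 (p := p) (B := B) (K := ∫ ω, |e 1 ω| ^ p ∂P) hp2
      (min_le_right _ _) (T := fun t ω => g.explorations γ (ε · ω) (e · ω) t)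
      (w := fun s ω => g.weight γ (ε · ω) (e · ω) s * g.regressor γ (ε · ω) (e · ω) s k)
      (e := fun s => e (s + 1))
      (fun s => g.measurable_noiseFiltration_noise γ hbr_meas hε_meas he_meas s.lt_succ_self)
      (fun s => he_resp (s + 1) (by omega)) (fun s => he_mean (s + 1) (by omega))
      (fun s => (hid (s + 1) (by omega)).integrable_iff.2 hint1)
      (fun s => (hid (s + 1) (by omega)).integral_eq.le)
      (fun s => ?_) (fun s ω => ?_) (fun ω => rfl) (fun s => ?_) (fun s ω => ?_)
    · refine Measurable.mul ?_ ((measurable_gradBasis_apply d k).comp (hresp s s le_rfl))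
      exact @measurable_ite_explores d Ω (𝓕 s) γ s _ (hcov s) _ _
        ((measurable_informative g.X).comp (hresp s s le_rfl)) measurable_const
    · rw [abs_mul, abs_of_nonneg (g.weight_nonneg γ _ _ s)]
      have h1 := hB _ (hX ▸ g.response_mem γ (ε · ω) (e · ω) hbr (s + 1)) k
      calc _ ≤ 1 * B := mul_le_mul (g.weight_le_one γ _ _ s) h1 (abs_nonneg _) zero_le_one
        _ = B := one_mul B
    · exact @Agent.measurable_explorations d Ω g γ (𝓕 s) ε e (s + 1) fun r hr k l =>
        (hcov r k l).mono (𝓕.mono (Nat.lt_succ_iff.1 hr)) le_rfl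
    · by_cases h : Explores γ s (g.state γ (ε · ω) (e · ω) s).cov
      · exact Or.inr (g.explorations_succ_of_explores γ _ _ h)
      · refine Or.inl ⟨g.explorations_succ_of_not_explores γ _ _ h, ?_⟩
        simp [Agent.weight, h]
  filter_upwards [ae_all_iff.2 key] with ω hω
  choose C hC using hω
  refine ⟨∑ k, |C k|, Finset.sum_nonneg fun _ _ => abs_nonneg _, fun t k => ?_⟩
  have hL : 0 ≤ ((g.explorations γ (ε · ω) (e · ω) t : ℝ) + 2)
      * Real.log (g.explorations γ (ε · ω) (e · ω) t + 2) := by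
    have := log_add_two_pos (g.explorations γ (ε · ω) (e · ω) t); positivity
  have hCle : C k ≤ ∑ k, |C k| := (le_abs_self _).trans (Finset.single_le_sum
    (f := fun k => |C k|) (fun _ _ => abs_nonneg _) (Finset.mem_univ k))
  refine le_trans (le_of_eq ?_) ((hC k t).trans (mul_le_mul_of_nonneg_right hCle hL))
  congr 1
  rw [Agent.noiseSum, Finset.sum_apply]
  refine Finset.sum_congr rfl fun s _ => ?_
  simp only [Pi.smul_apply, smul_eq_mul]
  ring

end RAID

/-! ### Assembly over rounds and agents. -/

namespace RAID

/-- Almost surely one agent explores `O(t^γ log t)` times and its type is estimated at the rate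
`t^(-γ)`. -/
theorem Agent.ae_explorations_le_and_isBigO_estimate {d : ℕ} (g : Agent d) {γ : ℝ} {Ω : Type*}
    [MeasurableSpace Ω] {P : Measure Ω} [IsProbabilityMeasure P] {ε e : ℕ → Ω → ℝ}
    {lo hi m M : ℝ} (hX : g.X = Set.Icc lo hi)
    (hθ : g.θ ∈ admissibleTypes g.X m M) (hm : 0 < m) (hbr : IsBestResponse g.X g.θ g.br)
    (hdes : g.xdes ∈ interior g.X) (h0 : g.cov₀.PosDef) (hγ0 : 0 < γ) (hγ1 : γ < 1)
    {v : ℝ≥0} (hv : v ≠ 0)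
    (hε_meas : ∀ t, Measurable (ε t)) (hε_law : ∀ t ≥ 1, P.map (ε t) = gaussianReal 0 v)
    (hε_indep : iIndepFun (fun t : ℕ => ε (t + 1)) P) (he_meas : ∀ t, Measurable (e t))
    (he_ident : ∀ t ≥ 1, IdentDistrib (e t) (e 1) P P) (he_mean : ∀ t ≥ 1, ∫ ω, e t ω ∂P = 0)
    {a : ℝ} (ha : 2 < a) (he_moment : ∫⁻ ω, ENNReal.ofReal (|e 1 ω| ^ a) ∂P < ∞)
    (he_resp : ∀ t ≥ 1, IndepFun (e t)
      (fun ω => ((fun s : Set.Icc 1 t => g.response γ (ε · ω) (e · ω) s),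
        (fun s : Set.Ico 1 t => e s ω))) P) :
    ∀ᵐ ω ∂P, (∃ K : ℝ, ∀ t, (g.explorations γ (ε · ω) (e · ω) t : ℝ) ≤ K * A γ t) ∧
      (fun t : ℕ => ‖WithLp.toLp 2 (g.estimate γ (ε · ω) (e · ω) t - g.θ)‖ ^ 2)
        =O[atTop] fun t : ℕ => (t : ℝ) ^ (-γ) := by
  have hbr_meas : Measurable g.br := ((hX ▸ hbr : IsBestResponse (Set.Icc lo hi) _ _).continuous
    (hX ▸ hθ) hm).measurable
  filter_upwards [g.ae_information_lower_bound γ (e := e) hX hθ hm hbr hdes h0 hv hε_meas hε_law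
    hε_indep, g.ae_noiseSum_sq_le γ hX hbr hbr_meas hε_meas he_meas he_ident he_mean ha he_moment
    he_resp] with ω ⟨c, hc, hinfo⟩ ⟨C, hC0, hnoise⟩
  -- Linear growth of the information is inverted into decay of the trace, the input to the
  -- exploration count.
  have hK : ∀ t, (g.state γ (ε · ω) (e · ω) t).cov.trace
      * (g.explorations γ (ε · ω) (e · ω) t + 1) ≤ d / c := by
    intro t
    have h1 : (0 : ℝ) < (g.explorations γ (ε · ω) (e · ω) t : ℝ) + 1 := by positivity
    have h2 := (g.posDef_information γ (ε · ω) (e · ω) h0 t).trace_inv_le (mul_pos hc h1) (hinfo t)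
    rw [← g.cov_eq_inv γ _ _ h0 t, ← div_div, le_div_iff₀ h1] at h2
    exact h2
  have hT := g.explorations_le_mul_A γ (ε · ω) (e · ω) hγ0.le (by positivity) hK
  exact ⟨⟨_, hT⟩, g.isBigO_estimate_sub γ _ _ hγ0 hγ1 h0 hC0 hT hnoise⟩

theorem regret_eq_sum {n d : ℕ} (g : Fin n → Agent d) (γ : ℝ) (ε e : Fin n → ℕ → ℝ) (t : ℕ) :
    regret g γ ε e t
      = ∑ i, ∑ τ ∈ Finset.Icc 1 t, ((g i).response γ (ε i) (e i) τ - (g i).xdes) ^ 2 := by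
  simp only [regret, EuclideanSpace.real_norm_sq_eq]
  exact Finset.sum_comm

end RAID

theorem theorem3 {Ω : Type*} [MeasurableSpace Ω] (P : Measure Ω) [IsProbabilityMeasure P]
    {n d : ℕ} (g : Fin n → RAID.Agent d)
    -- strategy sets are compact intervals
    (lo hi : Fin n → ℝ) (hX : ∀ i, (g i).X = Set.Icc (lo i) (hi i))
    -- the desired profile is a social optimum in the interior of the feasible set
    (Ψ : (Fin n → ℝ) → ℝ)
    (hdes : (fun i => (g i).xdes) ∈ RAID.socialOptima Ψ (Set.univ.pi fun i => (g i).X))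
    (hint : ∀ i, (g i).xdes ∈ interior (g i).X)
    -- admissible types and best responses
    (m M : Fin n → ℝ) (hm : ∀ i, 0 < m i) (hM : ∀ i, 0 < M i)
    (hθ : ∀ i, (g i).θ ∈ RAID.admissibleTypes (g i).X (m i) (M i))
    (hbr : ∀ i, RAID.IsBestResponse (g i).X (g i).θ (g i).br)
    -- parameters and initialization of the algorithm
    (γ : ℝ) (hγ : γ ∈ Set.Ico (2 / 3) 1) (σ : ℝ≥0) (hσ : 0 < σ)
    (hcov : ∀ i, (g i).cov₀.PosDef)
    -- i.i.d. Gaussian probing values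
    (ε : Fin n → ℕ → Ω → ℝ) (hε_meas : ∀ i t, Measurable (ε i t))
    (hε_law : ∀ i, ∀ t ≥ 1, P.map (ε i t) = gaussianReal 0 (σ ^ 2))
    (hε_indep : ∀ i, iIndepFun (fun t : ℕ => ε i (t + 1)) P)
    -- i.i.d. zero-mean noise with a bounded moment of order `a > 2`
    (e : Fin n → ℕ → Ω → ℝ) (he_meas : ∀ i t, Measurable (e i t))
    (he_indep : ∀ i, iIndepFun (fun t : ℕ => e i (t + 1)) P)
    (he_ident : ∀ i, ∀ t ≥ 1, IdentDistrib (e i t) (e i 1) P P)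
    (he_mean : ∀ i, ∀ t ≥ 1, ∫ ω, e i t ω ∂P = 0)
    (a : ℝ) (ha : 2 < a)
    (he_moment : ∀ i, (⨆ t : ℕ, ∫⁻ ω, ENNReal.ofReal (|e i (t + 1) ω| ^ a) ∂P) < ∞)
    -- the noise at time `t` is independent of the responses up to `t` and of the past noise
    (he_resp : ∀ i, ∀ t ≥ 1, IndepFun (e i t)
      (fun ω => ((fun s : Set.Icc 1 t => (g i).response γ (ε i · ω) (e i · ω) s),
        (fun s : Set.Ico 1 t => e i s ω))) P) :
    (∀ i, ∀ᵐ ω ∂P,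
      (fun t : ℕ => ‖WithLp.toLp 2 ((g i).estimate γ (ε i · ω) (e i · ω) t - (g i).θ)‖ ^ 2)
        =O[atTop] fun t : ℕ => (t : ℝ) ^ (-γ)) ∧
    (∀ᵐ ω ∂P,
      (fun t : ℕ => RAID.regret g γ (fun i s => ε i s ω) (fun i s => e i s ω) t)
        =O[atTop] fun t : ℕ => (t : ℝ) ^ γ * Real.log t) ∧
    (∀ᵐ ω ∂P,
      (fun t : ℕ => RAID.regret g γ (fun i s => ε i s ω) (fun i s => e i s ω) t)
        =o[atTop] fun t : ℕ => (t : ℝ)) := by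
  obtain ⟨hγ23, hγ1⟩ := hγ
  have hmoment : ∀ i, ∫⁻ ω, ENNReal.ofReal (|e i 1 ω| ^ a) ∂P < ∞ := fun i =>
    (le_iSup (fun t : ℕ => ∫⁻ ω, ENNReal.ofReal (|e i (t + 1) ω| ^ a) ∂P) 0).trans_lt (he_moment i)
  have hagent := fun i => (g i).ae_explorations_le_and_isBigO_estimate (hX i) (hθ i) (hm i) (hbr i)
    (hint i) (hcov i) (by linarith) hγ1 (pow_ne_zero 2 hσ.ne') (hε_meas i) (hε_law i) (hε_indep i)
    (he_meas i) (he_ident i) (he_mean i) ha (hmoment i) (he_resp i)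
  have hregret : ∀ᵐ ω ∂P,
      (fun t : ℕ => RAID.regret g γ (fun i s => ε i s ω) (fun i s => e i s ω) t)
        =O[atTop] RAID.A γ := by
    filter_upwards [ae_all_iff.2 hagent] with ω hω
    simp only [RAID.regret_eq_sum]
    refine IsBigO.fun_sum fun i _ => ?_
    obtain ⟨⟨K, hK⟩, hest⟩ := hω i
    exact (g i).isBigO_sum_sq_response_sub γ _ _ (hX i) (hθ i) (hm i) (hbr i)
      (interior_subset (hint i)) (by linarith) hK hest
  exact ⟨fun i => (hagent i).mono fun ω h => h.2, hregret,
    hregret.mono fun ω h => h.trans_isLittleO (RAID.isLittleO_A hγ1)⟩
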